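/- An involution is a permutation $\pi$ of $\{1,\dots,n\}$, $n\ge 0$, with $\pi=\pi^{-1}$; let $\mathcal I_n$ be the set of all of them (the identity included). An occurrence of a pattern $\tau=\tau_1\cdots\tau_m$ in $\pi$ is a choice of positions $1\le i_1<\dots<i_m\le n$ such that $(\pi(i_1),\dots,\pi(i_m))$ is order-isomorphic to $\tau$. An involution is even (resp. odd) if its number of occurrences of the pattern $21$ is even (resp. odd). For $r\ge 0$ let $E_r(x)=\sum_{n\ge 0} e_{r,n}x^n$ and $O_r(x)=\sum_{n\ge 0} o_{r,n}x^n$, where $e_{r,n}$ (resp. $o_{r,n}$) is the number of even (resp. odd) involutions in $\mathcal I_n$ that contain exactly $r$ occurrences of $3412$. **Corollary 4.4.** For every integer $r\ge 0$, the generating functions $E_r(x)$ and $O_r(x)$ are rational functions in $x$, $\sqrt{1-2x-3x^2}$ and $\sqrt{1-2x+5x^2}$. That is, in $\mathbb Q[[x]]$, where the square roots are the power series with constant term $1$, for each $F\in\{E_r,O_r\}$ there are polynomials $P,Q\in\mathbb Q[X,Y,Z]$ such that $$Q\bigl(x,\sqrt{1-2x-3x^2},\sqrt{1-2x+5x^2}\bigr)\ne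 0,\qquad F(x)=\frac{P\bigl(x,\sqrt{1-2x-3x^2},\sqrt{1-2x+5x^2}\bigr)}{Q\bigl(x,\sqrt{1-2x-3x^2},\sqrt{1-2x+5x^2}\bigr)}.$$ -/

import Mathlib

/-- The number of occurrences of the pattern (word) `τ` in the permutation `π` of `n` letters: the
number of strictly increasing sequences of positions `i 0 < i 1 < ⋯ < i (m - 1)` such that
`(π (i 0), …, π (i (m - 1)))` is order-isomorphic to `τ`. -/
def patternCount {m n : ℕ} (τ : Fin m → ℕ) (π : Equiv.Perm (Fin n)) : ℕ :=
  (Finset.univ.filter fun i : Fin m → Fin n =>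
    (∀ a b, a < b → i a < i b) ∧ ∀ a b, π (i a) < π (i b) ↔ τ a < τ b).card

/-- The involutions of `n` letters (permutations equal to their own inverse, the identity included)
that contain the pattern `3412` exactly `r` times. -/
def involutions3412 (r n : ℕ) : Finset (Equiv.Perm (Fin n)) :=
  Finset.univ.filter fun π => π = π⁻¹ ∧ patternCount ![3, 4, 1, 2] π = r

/-- The generating function of the even involutions (those with an even number of occurrences of
the pattern `21`) that contain `3412` exactly `r` times. -/
def evenGF (r : ℕ) : PowerSeries ℚ :=
  PowerSeries.mk fun n =>
    (((involutions3412 r n).filter fun π => Even (patternCount ![2, 1] π)).card : ℚ)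

/-- The generating function of the odd involutions (those with an odd number of occurrences of
the pattern `21`) that contain `3412` exactly `r` times. -/
def oddGF (r : ℕ) : PowerSeries ℚ :=
  PowerSeries.mk fun n =>
    (((involutions3412 r n).filter fun π => Odd (patternCount ![2, 1] π)).card : ℚ)

/-- The square root of a formal power series `f` with constant term `1`, by the binomial series
`√(1 + u) = ∑ k, (1/2 choose k) u ^ k` with `u = f - 1`. -/
noncomputable def seriesSqrt (f : PowerSeries ℚ) : PowerSeries ℚ :=
  (PowerSeries.binomialSeries ℚ (1 / 2 : ℚ)).subst (f - 1)

theorem hasSubst_sub_one {f : PowerSeries ℚ} (hf : PowerSeries.constantCoeff f = 1) :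
    PowerSeries.HasSubst (f - 1) :=
  PowerSeries.HasSubst.of_constantCoeff_zero' (by simp [hf])

theorem seriesSqrt_sq {f : PowerSeries ℚ} (hf : PowerSeries.constantCoeff f = 1) :
    seriesSqrt f ^ 2 = f := by
  have h := hasSubst_sub_one hf
  have h1 : PowerSeries.binomialSeries ℚ (1 / 2 : ℚ) ^ 2 = 1 + PowerSeries.X := by
    rw [sq, ← PowerSeries.binomialSeries_add]
    have := PowerSeries.binomialSeries_nat (R := ℚ) (A := ℚ) 1
    norm_num at this ⊢
    exact this
  rw [seriesSqrt, ← PowerSeries.subst_pow h, h1, ← PowerSeries.coe_substAlgHom h, map_add, map_one,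
    PowerSeries.substAlgHom_X]
  ring

theorem constantCoeff_seriesSqrt {f : PowerSeries ℚ} (hf : PowerSeries.constantCoeff f = 1) :
    PowerSeries.constantCoeff (seriesSqrt f) = 1 := by
  have h0 : PowerSeries.constantCoeff (f - 1) = 0 := by simp [hf]
  have h := hasSubst_sub_one hf
  have h2 : PowerSeries.binomialSeries ℚ (1 / 2 : ℚ)
      = (PowerSeries.binomialSeries ℚ (1 / 2 : ℚ) - 1) + 1 := by ring
  have h3 := PowerSeries.constantCoeff_subst_eq_zero (R := ℚ) (S := ℚ) (a := f - 1) h0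
    (PowerSeries.binomialSeries ℚ (1 / 2 : ℚ) - 1) (by simp)
  rw [seriesSqrt, h2, PowerSeries.subst_add h]
  rw [map_add]
  have h4 : (1 : PowerSeries ℚ).subst (f - 1) = 1 := by
    rw [← PowerSeries.coe_substAlgHom h, map_one]
  rw [h4, map_one]
  exact (congrArg (· + 1) h3).trans (by norm_num)

/-- `F` is a rational function, with rational coefficients, of the power series `u 0, …, u (k - 1)`:
it is the quotient `P(u) / Q(u)` of two polynomials in them, the denominator being nonzero. -/
def IsRationalFunctionOf {k : ℕ} (u : Fin k → PowerSeries ℚ) (F : PowerSeries ℚ) : Prop :=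
  ∃ P Q : MvPolynomial (Fin k) ℚ,
    MvPolynomial.aeval u Q ≠ 0 ∧ MvPolynomial.aeval u Q * F = MvPolynomial.aeval u P

/-! ### Rational functions of power series -/

namespace IsRationalFunctionOf

variable {k : ℕ} {u : Fin k → PowerSeries ℚ} {F G : PowerSeries ℚ}

/-! Let `G_r` be the generating function of the involutions with `r` occurrences of 3412, each
weighted by `t` to its number of two-cycles. On the inversions of an involution `π`, the map (a, b)
↦ (π b, π a) is an involution whose fixed points correspond to the two-cycles, so inversions and
two-cycles have the same parity. Hence the even and odd series are half the sum and half the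
difference of `G_r` at `t = 1` and `t = -1`. It remains to show that `G_r` is rational in `x` and
√((1 - x)² - 4tx²) for `t ≠ 0`.

Structure: call an invariant interval missing the first point a block. Deleting all blocks leaves
the core, which is primitive, that is, has no nonempty block. Each nonempty involution arises in
exactly one way from a primitive `κ` by inserting an arbitrary involution `τ j` right after the
`j`-th point of `κ`, for every `j`. A primitive involution is a fixed point, a two-cycle, or has at
least three points, each on a two-cycle that crosses another (`IsPrimitive.exists_crossing`). A
crossing is an occurrence of 3412, so in the last case the size is at most four times the number of
occurrences, and only finitely many cores matter for given `r`.

Counting: inserting `τ j` adds to the number of occurrences those of `τ j` and fixed multiples of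
its size and of its number of 12s (`occ_insert`). So only truncations of these three numbers matter,
and the tuples inserted into a fixed core split into finitely many boxes
(`gf_pi_rational_of_class`). The truncated classes are obtained from the `G_l`, from the classes
with prescribed numbers of 3412 and 12, and from polynomials (`signatureClass_rational`); the
classes with prescribed numbers of both patterns are rational by induction on the number of 12s
(`occInc_rational`).

Recursion: sorting by core gives G_r = L_r + x G_r + t x² ∑ G_i G_j over i + j = r, where L_r
collects the empty involution and the cores with at least three points. Such cores already contain
an occurrence, so L_r involves only smaller indices. For r = 0 one has L_0 = 1 and a quadratic
equation, whence the square root; for r > 0 the equation is linear in G_r with nonzero coefficient 1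
- x - 2 t x² G_0. -/

theorem of_aeval (P : MvPolynomial (Fin k) ℚ) : IsRationalFunctionOf u (MvPolynomial.aeval u P) :=
  ⟨P, 1, by simp, by simp⟩

theorem const (c : ℚ) : IsRationalFunctionOf u (PowerSeries.C c) := by
  have h := of_aeval (u := u) (MvPolynomial.C c)
  rwa [MvPolynomial.algHom_C] at h

theorem gen (i : Fin k) : IsRationalFunctionOf u (u i) := by
  have h := of_aeval (u := u) (MvPolynomial.X i)
  rwa [MvPolynomial.aeval_X] at h

theorem zero : IsRationalFunctionOf u 0 := by simpa using const (u := u) 0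

theorem one : IsRationalFunctionOf u 1 := by simpa using const (u := u) 1

theorem add (hF : IsRationalFunctionOf u F) (hG : IsRationalFunctionOf u G) :
    IsRationalFunctionOf u (F + G) := by
  obtain ⟨P, Q, hQ, h⟩ := hF
  obtain ⟨P', Q', hQ', h'⟩ := hG
  refine ⟨P * Q' + P' * Q, Q * Q', by simpa using ⟨hQ, hQ'⟩, ?_⟩
  simp only [map_mul, map_add, ← h, ← h']
  ring

theorem mul (hF : IsRationalFunctionOf u F) (hG : IsRationalFunctionOf u G) :
    IsRationalFunctionOf u (F * G) := by
  obtain ⟨P, Q, hQ, h⟩ := hF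
  obtain ⟨P', Q', hQ', h'⟩ := hG
  refine ⟨P * P', Q * Q', by simpa using ⟨hQ, hQ'⟩, ?_⟩
  simp only [map_mul, ← h, ← h']
  ring

theorem neg (hF : IsRationalFunctionOf u F) : IsRationalFunctionOf u (-F) := by
  obtain ⟨P, Q, hQ, h⟩ := hF
  exact ⟨-P, Q, hQ, by simp [← h]⟩

theorem sub (hF : IsRationalFunctionOf u F) (hG : IsRationalFunctionOf u G) :
    IsRationalFunctionOf u (F - G) := by
  rw [sub_eq_add_neg]
  exact hF.add hG.neg

theorem pow (hF : IsRationalFunctionOf u F) (n : ℕ) : IsRationalFunctionOf u (F ^ n) := by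
  induction n with
  | zero => simpa using one
  | succ n ih => rw [pow_succ]; exact ih.mul hF

theorem sum {ι : Type*} (s : Finset ι) {f : ι → PowerSeries ℚ}
    (h : ∀ i ∈ s, IsRationalFunctionOf u (f i)) : IsRationalFunctionOf u (∑ i ∈ s, f i) := by
  classical
  induction s using Finset.induction_on with
  | empty => simpa using zero
  | insert a s ha ih =>
    rw [Finset.sum_insert ha]
    exact (h a (by simp)).add (ih fun i hi => h i (by simp [hi]))

theorem prod {ι : Type*} (s : Finset ι) {f : ι → PowerSeries ℚ}
    (h : ∀ i ∈ s, IsRationalFunctionOf u (f i)) : IsRationalFunctionOf u (∏ i ∈ s, f i) := by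
  classical
  induction s using Finset.induction_on with
  | empty => simpa using one
  | insert a s ha ih =>
    rw [Finset.prod_insert ha]
    exact (h a (by simp)).mul (ih fun i hi => h i (by simp [hi]))

/-- Power series over a field form a domain, so a nonzero factor can be divided out. This solves the
linear equations that the generating functions satisfy. -/
theorem of_mul_left (hG0 : G ≠ 0) (hG : IsRationalFunctionOf u G)
    (h : IsRationalFunctionOf u (G * F)) : IsRationalFunctionOf u F := by
  obtain ⟨P, Q, hQ, h1⟩ := hG
  obtain ⟨P', Q', hQ', h2⟩ := h
  refine ⟨Q * P', Q' * P, ?_, ?_⟩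
  · rw [map_mul, ← h1]
    exact mul_ne_zero hQ' (mul_ne_zero hQ hG0)
  · simp only [map_mul, ← h1, ← h2]
    ring

theorem polynomial (hX : IsRationalFunctionOf u PowerSeries.X) (p : Polynomial ℚ) :
    IsRationalFunctionOf u (p : PowerSeries ℚ) := by
  induction p using Polynomial.induction_on' with
  | add p q hp hq => simpa using hp.add hq
  | monomial n c =>
    rw [← Polynomial.C_mul_X_pow_eq_monomial, Polynomial.coe_mul, Polynomial.coe_C,
      Polynomial.coe_pow, Polynomial.coe_X]
    exact (const c).mul (hX.pow n)

theorem of_eventually_zero (hX : IsRationalFunctionOf u PowerSeries.X) (N : ℕ)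
    (h : ∀ n, N ≤ n → PowerSeries.coeff n F = 0) : IsRationalFunctionOf u F := by
  have : F = (PowerSeries.trunc N F : Polynomial ℚ) := by
    ext n
    rw [Polynomial.coeff_coe, PowerSeries.coeff_trunc]
    split_ifs with hn
    · rfl
    · exact h n (not_lt.1 hn)
  rw [this]
  exact polynomial hX _

end IsRationalFunctionOf

/-! ### Weighted generating functions of sized types -/

/-- A size function with finite fibres. -/
class Sized (X : Type*) where
  size : X → ℕ
  finite_size : ∀ n, {x | size x = n}.Finite

namespace Sized

variable {X Y : Type*} [Sized X] [Sized Y]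

/-- The finite set of elements of size `n`. -/
noncomputable def fiber (X : Type*) [Sized X] (n : ℕ) : Finset X :=
  (finite_size (X := X) n).toFinset

@[simp] theorem mem_fiber {n : ℕ} {x : X} : x ∈ fiber X n ↔ size x = n := by
  simp [fiber]

open Classical in
/-- The generating function of the elements of `E`, with weights `w`. -/
noncomputable def gf (w : X → ℚ) (E : Set X) : PowerSeries ℚ :=
  PowerSeries.mk fun n => ∑ x ∈ fiber X n, if x ∈ E then w x else 0

open Classical in
theorem coeff_gf (w : X → ℚ) (E : Set X) (n : ℕ) :
    PowerSeries.coeff n (gf w E) = ∑ x ∈ fiber X n, if x ∈ E then w x else 0 := by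
  simp [gf]

theorem gf_union (w : X → ℚ) {E E' : Set X} (h : Disjoint E E') :
    gf w (E ∪ E') = gf w E + gf w E' := by
  classical
  ext n
  rw [map_add, coeff_gf, coeff_gf, coeff_gf, ← Finset.sum_add_distrib]
  refine Finset.sum_congr rfl fun x _ => ?_
  have h0 : x ∈ E → x ∉ E' := fun h1 => Set.disjoint_left.1 h h1
  by_cases h1 : x ∈ E <;> by_cases h2 : x ∈ E' <;> simp_all

theorem gf_eq_add_diff (w : X → ℚ) (E E' : Set X) : gf w E = gf w (E ∩ E') + gf w (E \ E') := by
  rw [← gf_union w Set.disjoint_sdiff_inter.symm, Set.inter_union_sdiff]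

theorem gf_fiberwise (w : X → ℚ) {E : Set X} {ι : Type*} (s : Finset ι) (c : X → ι)
    (h : ∀ x ∈ E, c x ∈ s) : gf w E = ∑ i ∈ s, gf w {x | x ∈ E ∧ c x = i} := by
  classical
  ext n
  rw [map_sum]
  simp only [coeff_gf]
  rw [Finset.sum_comm]
  refine Finset.sum_congr rfl fun x _ => ?_
  by_cases hx : x ∈ E
  · simp [hx, h x hx]
  · simp [hx]

theorem gf_rational_of_size_lt {k : ℕ} {u : Fin k → PowerSeries ℚ}
    (hX : IsRationalFunctionOf u PowerSeries.X) (w : X → ℚ) {E : Set X} (N : ℕ)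
    (h : ∀ x ∈ E, size x < N) : IsRationalFunctionOf u (gf w E) := by
  classical
  refine IsRationalFunctionOf.of_eventually_zero hX N fun n hn => ?_
  rw [coeff_gf]
  refine Finset.sum_eq_zero fun x hx => ?_
  rw [mem_fiber] at hx
  rw [if_neg]
  intro hxE
  have := h x hxE
  omega

/-- The intended `φ` is insertion into a fixed core: it adds the size of the core and multiplies the
weight by `t` to the number of two-cycles of the core. -/
theorem gf_image {w : X → ℚ} {w' : Y → ℚ} (φ : X → Y) (hφ : Function.Injective φ) (k : ℕ) (c : ℚ)
    (hs : ∀ x, size (φ x) = size x + k) (hw : ∀ x, w' (φ x) = c * w x) (E : Set X) :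
    gf w' (φ '' E) = PowerSeries.X ^ k * (PowerSeries.C c * gf w E) := by
  classical
  ext n
  rw [PowerSeries.coeff_X_pow_mul', PowerSeries.coeff_C_mul, coeff_gf, coeff_gf]
  rw [← Finset.sum_filter]
  split_ifs with hk
  · rw [← Finset.sum_filter, Finset.mul_sum]
    symm
    refine Finset.sum_bij (fun x _ => φ x) ?_ ?_ ?_ ?_
    · intro x hx
      simp only [Finset.mem_filter, mem_fiber] at hx ⊢
      exact ⟨by rw [hs]; omega, x, hx.2, rfl⟩
    · intro x _ y _ hxy
      exact hφ hxy
    · intro y hy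
      simp only [Finset.mem_filter, mem_fiber] at hy
      obtain ⟨hy, x, hx, rfl⟩ := hy
      rw [hs] at hy
      exact ⟨x, by simp only [Finset.mem_filter, mem_fiber]; exact ⟨by omega, hx⟩, rfl⟩
    · intro x _
      rw [hw]
  · refine Finset.sum_eq_zero fun y hy => ?_
    simp only [Finset.mem_filter, mem_fiber] at hy
    obtain ⟨hy, x, hx, rfl⟩ := hy
    rw [hs] at hy
    omega

instance instProd : Sized (X × Y) where
  size p := size p.1 + size p.2
  finite_size n := by
    refine (((Set.finite_Iic n).biUnion fun i _ => finite_size (X := X) i).prod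
      ((Set.finite_Iic n).biUnion fun i _ => finite_size (X := Y) i)).subset ?_
    rintro ⟨x, y⟩ h
    simp only [Set.mem_ofPred_eq] at h
    simp only [Set.mem_prod, Set.mem_iUnion, Set.mem_ofPred_eq, Set.mem_Iic, exists_prop]
    exact ⟨⟨_, by omega, rfl⟩, ⟨_, by omega, rfl⟩⟩

theorem size_prod (p : X × Y) : size p = size p.1 + size p.2 := rfl

theorem gf_prod (w : X → ℚ) (w' : Y → ℚ) (E : Set X) (E' : Set Y) :
    gf (fun p : X × Y => w p.1 * w' p.2) (E ×ˢ E') = gf w E * gf w' E' := by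
  classical
  ext n
  rw [PowerSeries.coeff_mul, coeff_gf]
  simp only [coeff_gf]
  have : fiber (X × Y) n = (Finset.HasAntidiagonal.antidiagonal n).biUnion
      fun ij => fiber X ij.1 ×ˢ fiber Y ij.2 := by
    ext ⟨x, y⟩
    simp [size_prod]
  rw [this, Finset.sum_biUnion]
  · refine Finset.sum_congr rfl fun ij _ => ?_
    rw [Finset.sum_product, Finset.sum_mul_sum]
    refine Finset.sum_congr rfl fun x _ => Finset.sum_congr rfl fun y _ => ?_
    by_cases hx : x ∈ E <;> by_cases hy : y ∈ E' <;> simp [hx, hy]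
  · rintro ⟨i, j⟩ _ ⟨i', j'⟩ _ hne
    rw [Function.onFun, Finset.disjoint_left]
    rintro ⟨x, y⟩ h1 h2
    simp only [Finset.mem_product, mem_fiber] at h1 h2
    exact hne (by rw [← h1.1, ← h1.2, ← h2.1, ← h2.2])

instance instPi (m : ℕ) : Sized (Fin m → X) where
  size τ := ∑ j, size (τ j)
  finite_size n := by
    refine (Set.Finite.pi' (t := fun _ : Fin m => ⋃ i ∈ Set.Iic n, {x : X | size x = i})
      fun _ => (Set.finite_Iic n).biUnion fun i _ => finite_size (X := X) i).subset ?_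
    intro τ h j
    simp only [Set.mem_ofPred_eq] at h
    simp only [Set.mem_iUnion, Set.mem_ofPred_eq, Set.mem_Iic, exists_prop]
    refine ⟨_, ?_, rfl⟩
    rw [← h]
    exact Finset.single_le_sum (f := fun j => size (τ j)) (fun _ _ => Nat.zero_le _)
      (Finset.mem_univ j)

theorem size_pi {m : ℕ} (τ : Fin m → X) : size τ = ∑ j, size (τ j) := rfl

theorem gf_pi (w : X → ℚ) {m : ℕ} (E : Fin m → Set X) :
    gf (fun τ : Fin m → X => ∏ j, w (τ j)) (Set.univ.pi E) = ∏ j, gf w (E j) := by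
  classical
  induction m with
  | zero =>
    ext n
    have h0 : ∀ τ : Fin 0 → X, size τ = 0 := fun τ => by simp [size_pi]
    rw [coeff_gf]
    rcases n with _ | n
    · have : fiber (Fin 0 → X) 0 = {Fin.elim0} := by
        ext τ
        simp only [mem_fiber, h0, true_iff, Finset.mem_singleton]
        exact Subsingleton.elim _ _
      rw [this]
      simp
    · have : fiber (Fin 0 → X) (n + 1) = ∅ := by
        ext τ
        simp [h0]
      rw [this]
      simp [PowerSeries.coeff_one]
  | succ m ih =>
    rw [Fin.prod_univ_succ, ← ih fun j => E j.succ, ← gf_prod]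
    have h := gf_image (w := fun p : X × (Fin m → X) => w p.1 * ∏ j, w (p.2 j))
      (w' := fun τ : Fin (m + 1) → X => ∏ j, w (τ j)) (fun p => (Fin.cons p.1 p.2 : Fin (m + 1) → X))
      (fun p q h => by
        have h' := Fin.cons_injective2 h
        exact Prod.ext h'.1 h'.2) 0 1
      (fun p => by simp [size_prod, size_pi, Fin.sum_univ_succ])
      (fun p => by simp [Fin.prod_univ_succ]) (E 0 ×ˢ Set.univ.pi fun j => E j.succ)
    rw [pow_zero, one_mul, map_one, one_mul] at h
    rw [← h]
    congr 1
    ext τ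
    simp only [Set.mem_univ_pi, Set.mem_image, Set.mem_prod, Prod.exists]
    constructor
    · intro hτ
      exact ⟨τ 0, fun j => τ j.succ, ⟨hτ 0, fun j => hτ _⟩, Fin.cons_self_tail τ⟩
    · rintro ⟨x, y, ⟨hx, hy⟩, rfl⟩ j
      refine Fin.cases ?_ (fun j => ?_) j
      · simpa using hx
      · simpa using hy j

/-- A set of tuples that is a union of boxes of classes of `c` has a rational generating function
if the classes that it meets do. -/
theorem gf_pi_rational_of_class {k : ℕ} {u : Fin k → PowerSeries ℚ} (w : X → ℚ) {m : ℕ}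
    {ι : Type*} [Fintype ι] (c : X → ι) (E : Set (Fin m → X))
    (hE : ∀ τ τ' : Fin m → X, (∀ j, c (τ j) = c (τ' j)) → τ ∈ E → τ' ∈ E)
    (hc : ∀ τ ∈ E, ∀ j, IsRationalFunctionOf u (gf w {x | c x = c (τ j)})) :
    IsRationalFunctionOf u (gf (fun τ : Fin m → X => ∏ j, w (τ j)) E) := by
  classical
  rw [gf_fiberwise _ Finset.univ (fun τ j => c (τ j)) fun _ _ => Finset.mem_univ _]
  refine IsRationalFunctionOf.sum _ fun σ _ => ?_
  by_cases h : ∃ τ ∈ E, (fun j => c (τ j)) = σ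
  · obtain ⟨τ, hτ, rfl⟩ := h
    have : {τ' | τ' ∈ E ∧ (fun j => c (τ' j)) = fun j => c (τ j)}
        = Set.univ.pi fun j => {x | c x = c (τ j)} := by
      ext τ'
      simp only [Set.mem_ofPred_eq, Set.mem_univ_pi, funext_iff]
      exact ⟨fun h => h.2, fun h => ⟨hE τ τ' (fun j => (h j).symm) hτ, h⟩⟩
    rw [this, gf_pi]
    exact IsRationalFunctionOf.prod _ fun j _ => hc τ hτ j
  · have : {τ' | τ' ∈ E ∧ (fun j => c (τ' j)) = σ} = ∅ := by
      ext τ'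
      simp only [Set.mem_ofPred_eq, Set.mem_empty_iff_false, iff_false]
      exact fun h' => h ⟨τ', h'.1, h'.2⟩
    rw [this]
    have : gf (fun τ : Fin m → X => ∏ j, w (τ j)) ∅ = 0 := by
      ext n
      simp [coeff_gf]
    rw [this]
    exact IsRationalFunctionOf.zero

end Sized

/-! ### Pattern statistics on finite subsets of linear orders -/

namespace InvolutionPattern

section Sums

variable {α : Type*}

theorem sum_le_sum_subset {S T : Finset α} (h : S ⊆ T) {F G : α → ℕ} (hFG : ∀ a ∈ S, F a ≤ G a) :
    ∑ a ∈ S, F a ≤ ∑ a ∈ T, G a :=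
  (Finset.sum_le_sum hFG).trans (Finset.sum_le_sum_of_subset h)

theorem one_le_sum {S : Finset α} {F : α → ℕ} {a : α} (ha : a ∈ S) (h : 1 ≤ F a) :
    1 ≤ ∑ a ∈ S, F a :=
  h.trans (Finset.single_le_sum (fun _ _ => Nat.zero_le _) ha)

theorem sum_congr_two {M : Type*} [AddCommMonoid M] {S T : Finset α} {F G : α → α → M}
    (h : ∀ a ∈ S, ∀ b ∈ T, F a b = G a b) :
    ∑ a ∈ S, ∑ b ∈ T, F a b = ∑ a ∈ S, ∑ b ∈ T, G a b :=
  Finset.sum_congr rfl fun a ha => Finset.sum_congr rfl fun b hb => h a ha b hb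

theorem sum_congr_three {M : Type*} [AddCommMonoid M] {S T U : Finset α} {F G : α → α → α → M}
    (h : ∀ a ∈ S, ∀ b ∈ T, ∀ c ∈ U, F a b c = G a b c) :
    ∑ a ∈ S, ∑ b ∈ T, ∑ c ∈ U, F a b c = ∑ a ∈ S, ∑ b ∈ T, ∑ c ∈ U, G a b c :=
  Finset.sum_congr rfl fun a ha => sum_congr_two fun b hb c hc => h a ha b hb c hc

theorem sum_congr_four {M : Type*} [AddCommMonoid M] {S T U V : Finset α}
    {F G : α → α → α → α → M}
    (h : ∀ a ∈ S, ∀ b ∈ T, ∀ c ∈ U, ∀ d ∈ V, F a b c d = G a b c d) :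
    ∑ a ∈ S, ∑ b ∈ T, ∑ c ∈ U, ∑ d ∈ V, F a b c d =
      ∑ a ∈ S, ∑ b ∈ T, ∑ c ∈ U, ∑ d ∈ V, G a b c d :=
  Finset.sum_congr rfl fun a ha => sum_congr_three fun b hb c hc d hd => h a ha b hb c hc d hd

theorem sum_eq_zero_four {S T U V : Finset α} {P : α → α → α → α → Prop}
    [∀ a b c d, Decidable (P a b c d)]
    (h : ∀ a ∈ S, ∀ b ∈ T, ∀ c ∈ U, ∀ d ∈ V, ¬ P a b c d) :
    ∑ a ∈ S, ∑ b ∈ T, ∑ c ∈ U, ∑ d ∈ V, (if P a b c d then 1 else 0) = 0 := by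
  rw [sum_congr_four (G := fun _ _ _ _ => 0) fun a ha b hb c hc d hd => if_neg (h a ha b hb c hc d hd)]
  simp

end Sums

variable {α β : Type*} [LinearOrder α] [LinearOrder β]

/-- The number of occurrences of `3412` in the restriction of `f` to `S`. -/
def occ (S : Finset α) (f : α → α) : ℕ :=
  ∑ a ∈ S, ∑ b ∈ S, ∑ c ∈ S, ∑ d ∈ S,
    if a < b ∧ b < c ∧ c < d ∧ f c < f d ∧ f d < f a ∧ f a < f b then 1 else 0

/-- The number of occurrences of `12` in the restriction of `f` to `S`. -/
def inc (S : Finset α) (f : α → α) : ℕ :=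
  ∑ a ∈ S, ∑ b ∈ S, if a < b ∧ f a < f b then 1 else 0

/-- The number of exceedances of `f` in `S`; for an involution, its number of two-cycles. -/
def arcs (S : Finset α) (f : α → α) : ℕ :=
  ∑ a ∈ S, if a < f a then 1 else 0

/-! ### Invariance of the statistics under increasing relabelling -/

section Image

variable {S : Finset α} {f : α → α} {g : β → β} {e : α → β}

theorem occ_image (he : StrictMonoOn e S) (hf : ∀ x ∈ S, f x ∈ S) (h : ∀ x ∈ S, g (e x) = e (f x)) :
    occ (S.image e) g = occ S f := by
  unfold occ
  simp only [Finset.sum_image he.injOn]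
  refine Finset.sum_congr rfl fun a ha => Finset.sum_congr rfl fun b hb =>
    Finset.sum_congr rfl fun c hc => Finset.sum_congr rfl fun d hd => ?_
  simp only [h a ha, h b hb, h c hc, h d hd, he.lt_iff_lt ha hb, he.lt_iff_lt hb hc,
    he.lt_iff_lt hc hd, he.lt_iff_lt (hf c hc) (hf d hd), he.lt_iff_lt (hf d hd) (hf a ha),
    he.lt_iff_lt (hf a ha) (hf b hb)]

theorem inc_image (he : StrictMonoOn e S) (hf : ∀ x ∈ S, f x ∈ S) (h : ∀ x ∈ S, g (e x) = e (f x)) :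
    inc (S.image e) g = inc S f := by
  unfold inc
  simp only [Finset.sum_image he.injOn]
  refine Finset.sum_congr rfl fun a ha => Finset.sum_congr rfl fun b hb => ?_
  simp only [h a ha, h b hb, he.lt_iff_lt ha hb, he.lt_iff_lt (hf a ha) (hf b hb)]

theorem arcs_image (he : StrictMonoOn e S) (hf : ∀ x ∈ S, f x ∈ S)
    (h : ∀ x ∈ S, g (e x) = e (f x)) : arcs (S.image e) g = arcs S f := by
  unfold arcs
  rw [Finset.sum_image he.injOn]
  refine Finset.sum_congr rfl fun a ha => ?_
  simp only [h a ha, he.lt_iff_lt ha (hf a ha)]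

end Image

theorem occ_mono {S T : Finset α} (h : S ⊆ T) (f : α → α) : occ S f ≤ occ T f :=
  sum_le_sum_subset h fun _ _ => sum_le_sum_subset h fun _ _ => sum_le_sum_subset h fun _ _ =>
    sum_le_sum_subset h fun _ _ => le_rfl

theorem inc_mono {S T : Finset α} (h : S ⊆ T) (f : α → α) : inc S f ≤ inc T f :=
  sum_le_sum_subset h fun _ _ => sum_le_sum_subset h fun _ _ => le_rfl

theorem one_le_inc {S : Finset α} {f : α → α} {a b : α} (ha : a ∈ S) (hb : b ∈ S) (hab : a < b)
    (h : f a < f b) : 1 ≤ inc S f :=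
  one_le_sum ha (one_le_sum hb (by simp [hab, h]))

/-! ### The contribution of an invariant interval -/

/-- The number of triples of points of `T` that complete each point of an invariant interval,
placed above the points that satisfy `lo` and below the others, to an occurrence of `3412`. -/
noncomputable def occPoint (T : Finset α) (f : α → α) (lo : α → Prop) : ℕ := by
  classical
  exact (∑ b ∈ T, ∑ c ∈ T, ∑ d ∈ T,
      if ¬ lo b ∧ b < c ∧ c < d ∧ f c < f d ∧ lo (f d) ∧ ¬ lo (f b) then 1 else 0) +
    (∑ a ∈ T, ∑ c ∈ T, ∑ d ∈ T,
      if lo a ∧ ¬ lo c ∧ c < d ∧ f c < f d ∧ f d < f a ∧ lo (f a) then 1 else 0) +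
    (∑ a ∈ T, ∑ b ∈ T, ∑ d ∈ T,
      if a < b ∧ lo b ∧ ¬ lo d ∧ ¬ lo (f d) ∧ f d < f a ∧ f a < f b then 1 else 0) +
    ∑ a ∈ T, ∑ b ∈ T, ∑ c ∈ T,
      if a < b ∧ b < c ∧ lo c ∧ lo (f c) ∧ ¬ lo (f a) ∧ f a < f b then 1 else 0

/-- The number of pairs of points of `T` that complete each increasing pair of an invariant
interval, placed above the points that satisfy `lo` and below the others, to an occurrence of
`3412`. -/
noncomputable def occPair (T : Finset α) (f : α → α) (lo : α → Prop) : ℕ := by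
  classical
  exact (∑ c ∈ T, ∑ d ∈ T, if ¬ lo c ∧ c < d ∧ f c < f d ∧ lo (f d) then 1 else 0) +
    ∑ a ∈ T, ∑ b ∈ T, if a < b ∧ lo b ∧ ¬ lo (f a) ∧ f a < f b then 1 else 0

/-- The number of points of `T` that form an increasing pair with each point of an invariant
interval, placed above the points that satisfy `lo` and below the others. -/
noncomputable def incPoint (T : Finset α) (f : α → α) (lo : α → Prop) : ℕ := by
  classical
  exact (∑ a ∈ T, if lo a ∧ lo (f a) then 1 else 0) + ∑ b ∈ T, if ¬ lo b ∧ ¬ lo (f b) then 1 else 0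

section Congr

variable {T : Finset α} {f g : α → α} (lo : α → Prop)

theorem occ_congr (h : ∀ x ∈ T, f x = g x) : occ T f = occ T g :=
  sum_congr_four fun a ha b hb c hc d hd => by rw [h a ha, h b hb, h c hc, h d hd]

theorem inc_congr (h : ∀ x ∈ T, f x = g x) : inc T f = inc T g :=
  sum_congr_two fun a ha b hb => by rw [h a ha, h b hb]

theorem occPoint_congr (h : ∀ x ∈ T, f x = g x) : occPoint T f lo = occPoint T g lo := by
  classical
  unfold occPoint
  refine congrArg₂ (· + ·) (congrArg₂ (· + ·) (congrArg₂ (· + ·) ?_ ?_) ?_) ?_ <;>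
    refine sum_congr_three fun a ha b hb c hc => ?_ <;>
    simp only [h a ha, h b hb, h c hc]

theorem occPair_congr (h : ∀ x ∈ T, f x = g x) : occPair T f lo = occPair T g lo := by
  classical
  unfold occPair
  refine congrArg₂ (· + ·) ?_ ?_ <;>
    refine sum_congr_two fun a ha b hb => ?_ <;>
    simp only [h a ha, h b hb]

theorem incPoint_congr {α : Type*} {T : Finset α} {f g : α → α} (lo : α → Prop)
    (h : ∀ x ∈ T, f x = g x) : incPoint T f lo = incPoint T g lo := by
  classical
  unfold incPoint
  refine congrArg₂ (· + ·) ?_ ?_ <;>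
    refine Finset.sum_congr rfl fun a ha => ?_ <;>
    simp only [h a ha]

end Congr

section Insert

variable {T I : Finset α} {f : α → α} {lo : α → Prop}

theorem disjoint_of_side (hlo : ∀ p ∈ T, ∀ q ∈ I, lo p → p < q)
    (hhi : ∀ p ∈ T, ∀ q ∈ I, ¬ lo p → q < p) : Disjoint T I :=
  Finset.disjoint_left.2 fun p hT hI => by
    by_cases h : lo p
    · exact lt_irrefl _ (hlo p hT p hI h)
    · exact lt_irrefl _ (hhi p hT p hI h)

/-- No point of `T` lies between two points of `I`, and both sets are invariant, so `I` is an
interval in positions and in values alike. A single point of an occurrence inside `I` may be any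
point of `I`; two of them must play 34 or 12 and form an increasing pair. Every other mixed
distribution would put a point of `T` between two of `I`, in position or in value. -/
theorem occ_insert (hfT : ∀ p ∈ T, f p ∈ T) (hfI : ∀ q ∈ I, f q ∈ I)
    (hlo : ∀ p ∈ T, ∀ q ∈ I, lo p → p < q) (hhi : ∀ p ∈ T, ∀ q ∈ I, ¬ lo p → q < p) :
    occ (T ∪ I) f = occ T f + I.card * occPoint T f lo + inc I f * occPair T f lo + occ I f := by
  classical
  have hd := disjoint_of_side hlo hhi
  have btw : ∀ p ∈ T, ∀ q ∈ I, ∀ q' ∈ I, q < p → p < q' → False := by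
    intro p hp q hq q' hq' h1 h2
    by_cases h : lo p
    · exact lt_asymm h1 (hlo p hp q hq h)
    · exact lt_asymm h2 (hhi p hp q' hq' h)
  have lt_iff : ∀ p ∈ T, ∀ q ∈ I, (p < q ↔ lo p) := fun p hp q hq =>
    ⟨fun h => by_contra fun h' => lt_asymm h (hhi p hp q hq h'), hlo p hp q hq⟩
  have gt_iff : ∀ p ∈ T, ∀ q ∈ I, (q < p ↔ ¬ lo p) := fun p hp q hq =>
    ⟨fun h h' => lt_asymm h (hlo p hp q hq h'), hhi p hp q hq⟩
  set P : α → α → α → α → Prop := fun a b c d =>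
    a < b ∧ b < c ∧ c < d ∧ f c < f d ∧ f d < f a ∧ f a < f b with hP
  have key : ∀ A B C D : Finset α, ∑ a ∈ A, ∑ b ∈ B, ∑ c ∈ C, ∑ d ∈ D,
      (if P a b c d then 1 else 0) = ∑ a ∈ A, ∑ b ∈ B, ∑ c ∈ C, ∑ d ∈ D,
      if a < b ∧ b < c ∧ c < d ∧ f c < f d ∧ f d < f a ∧ f a < f b then 1 else 0 :=
    fun _ _ _ _ => rfl
  -- In `e1` to `e4` one point lies in `I` and plays 3, 4, 1, 2 in turn. Its comparisons with `T`
  -- are decided by `lo`, so all points of `I` count equally.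
  have e1 : ∑ a ∈ I, ∑ b ∈ T, ∑ c ∈ T, ∑ d ∈ T, (if P a b c d then 1 else 0) =
      I.card * ∑ b ∈ T, ∑ c ∈ T, ∑ d ∈ T,
        if ¬ lo b ∧ b < c ∧ c < d ∧ f c < f d ∧ lo (f d) ∧ ¬ lo (f b) then 1 else 0 := by
    rw [← smul_eq_mul, ← Finset.sum_const]
    refine sum_congr_four fun a ha b hb c hc d hd => ?_
    simp only [hP, gt_iff b hb a ha, gt_iff _ (hfT b hb) _ (hfI a ha),
      lt_iff _ (hfT d hd) _ (hfI a ha)]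
  have e2 : ∑ a ∈ T, ∑ b ∈ I, ∑ c ∈ T, ∑ d ∈ T, (if P a b c d then 1 else 0) =
      I.card * ∑ a ∈ T, ∑ c ∈ T, ∑ d ∈ T,
        if lo a ∧ ¬ lo c ∧ c < d ∧ f c < f d ∧ f d < f a ∧ lo (f a) then 1 else 0 := by
    rw [Finset.sum_comm, ← smul_eq_mul, ← Finset.sum_const]
    refine sum_congr_four fun b hb a ha c hc d hd => ?_
    simp only [hP, gt_iff c hc b hb, lt_iff a ha b hb, lt_iff _ (hfT a ha) _ (hfI b hb)]
  have e3 : ∑ a ∈ T, ∑ b ∈ T, ∑ c ∈ I, ∑ d ∈ T, (if P a b c d then 1 else 0) =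
      I.card * ∑ a ∈ T, ∑ b ∈ T, ∑ d ∈ T,
        if a < b ∧ lo b ∧ ¬ lo d ∧ ¬ lo (f d) ∧ f d < f a ∧ f a < f b then 1 else 0 := by
    rw [← smul_eq_mul, ← Finset.sum_const]
    simp only [Finset.sum_comm (s := T) (t := I)]
    refine sum_congr_four fun c hc a ha b hb d hd => ?_
    simp only [hP, gt_iff d hd c hc, lt_iff b hb c hc, gt_iff _ (hfT d hd) _ (hfI c hc)]
  have e4 : ∑ a ∈ T, ∑ b ∈ T, ∑ c ∈ T, ∑ d ∈ I, (if P a b c d then 1 else 0) =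
      I.card * ∑ a ∈ T, ∑ b ∈ T, ∑ c ∈ T,
        if a < b ∧ b < c ∧ lo c ∧ lo (f c) ∧ ¬ lo (f a) ∧ f a < f b then 1 else 0 := by
    rw [← smul_eq_mul, ← Finset.sum_const]
    simp only [Finset.sum_comm (s := T) (t := I)]
    refine sum_congr_four fun d hd a ha b hb c hc => ?_
    simp only [hP, lt_iff c hc d hd, lt_iff _ (hfT c hc) _ (hfI d hd),
      gt_iff _ (hfT a ha) _ (hfI d hd)]
  -- In `e5` and `e6` the increasing pair in `I` plays 34, respectively 12.
  have e5 : ∑ a ∈ I, ∑ b ∈ I, ∑ c ∈ T, ∑ d ∈ T, (if P a b c d then 1 else 0) =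
      inc I f * ∑ c ∈ T, ∑ d ∈ T, if ¬ lo c ∧ c < d ∧ f c < f d ∧ lo (f d) then 1 else 0 := by
    simp only [inc, Finset.sum_mul]
    refine sum_congr_two fun a ha b hb => ?_
    rw [Finset.mul_sum]
    refine Finset.sum_congr rfl fun c hc => ?_
    rw [Finset.mul_sum]
    refine Finset.sum_congr rfl fun d hd => ?_
    simp only [hP, gt_iff c hc b hb, lt_iff _ (hfT d hd) _ (hfI a ha), ite_zero_mul_ite_zero,
      mul_one]
    exact if_congr (by tauto) rfl rfl
  have e6 : ∑ a ∈ T, ∑ b ∈ T, ∑ c ∈ I, ∑ d ∈ I, (if P a b c d then 1 else 0) =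
      inc I f * ∑ a ∈ T, ∑ b ∈ T, if a < b ∧ lo b ∧ ¬ lo (f a) ∧ f a < f b then 1 else 0 := by
    simp only [inc, Finset.mul_sum]
    refine sum_congr_two fun a ha b hb => ?_
    rw [Finset.sum_mul]
    refine Finset.sum_congr rfl fun c hc => ?_
    rw [Finset.sum_mul]
    refine Finset.sum_congr rfl fun d hd => ?_
    simp only [hP, lt_iff b hb c hc, gt_iff _ (hfT a ha) _ (hfI d hd), ite_zero_mul_ite_zero,
      mul_one]
    exact if_congr (by tauto) rfl rfl
  have z1 : ∑ a ∈ I, ∑ b ∈ T, ∑ c ∈ I, ∑ d ∈ T, (if P a b c d then 1 else 0) = 0 :=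
    sum_eq_zero_four fun a ha b hb c hc d hd h => btw b hb a ha c hc h.1 h.2.1
  have z2 : ∑ a ∈ I, ∑ b ∈ T, ∑ c ∈ T, ∑ d ∈ I, (if P a b c d then 1 else 0) = 0 :=
    sum_eq_zero_four fun a ha b hb c hc d hd h =>
      btw b hb a ha d hd h.1 (h.2.1.trans h.2.2.1)
  have z3 : ∑ a ∈ T, ∑ b ∈ I, ∑ c ∈ T, ∑ d ∈ I, (if P a b c d then 1 else 0) = 0 :=
    sum_eq_zero_four fun a ha b hb c hc d hd h => btw c hc b hb d hd h.2.1 h.2.2.1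
  have z4 : ∑ a ∈ T, ∑ b ∈ I, ∑ c ∈ I, ∑ d ∈ T, (if P a b c d then 1 else 0) = 0 :=
    sum_eq_zero_four fun a ha b hb c hc d hd h =>
      btw _ (hfT a ha) _ (hfI c hc) _ (hfI b hb) (h.2.2.2.1.trans h.2.2.2.2.1) h.2.2.2.2.2
  have z5 : ∑ a ∈ I, ∑ b ∈ I, ∑ c ∈ I, ∑ d ∈ T, (if P a b c d then 1 else 0) = 0 :=
    sum_eq_zero_four fun a ha b hb c hc d hd h =>
      btw _ (hfT d hd) _ (hfI c hc) _ (hfI a ha) h.2.2.2.1 h.2.2.2.2.1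
  have z6 : ∑ a ∈ I, ∑ b ∈ I, ∑ c ∈ T, ∑ d ∈ I, (if P a b c d then 1 else 0) = 0 :=
    sum_eq_zero_four fun a ha b hb c hc d hd h => btw c hc b hb d hd h.2.1 h.2.2.1
  have z7 : ∑ a ∈ I, ∑ b ∈ T, ∑ c ∈ I, ∑ d ∈ I, (if P a b c d then 1 else 0) = 0 :=
    sum_eq_zero_four fun a ha b hb c hc d hd h => btw b hb a ha c hc h.1 h.2.1
  have z8 : ∑ a ∈ T, ∑ b ∈ I, ∑ c ∈ I, ∑ d ∈ I, (if P a b c d then 1 else 0) = 0 :=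
    sum_eq_zero_four fun a ha b hb c hc d hd h =>
      btw _ (hfT a ha) _ (hfI d hd) _ (hfI b hb) h.2.2.2.2.1 h.2.2.2.2.2
  have main : occ (T ∪ I) f = ∑ a ∈ T ∪ I, ∑ b ∈ T ∪ I, ∑ c ∈ T ∪ I, ∑ d ∈ T ∪ I,
      (if P a b c d then 1 else 0) := by
    rw [key]
    rfl
  have hT : occ T f = ∑ a ∈ T, ∑ b ∈ T, ∑ c ∈ T, ∑ d ∈ T, (if P a b c d then 1 else 0) := by
    rw [key]
    rfl
  have hI : occ I f = ∑ a ∈ I, ∑ b ∈ I, ∑ c ∈ I, ∑ d ∈ I, (if P a b c d then 1 else 0) := by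
    rw [key]
    rfl
  rw [main, hT, hI]
  simp only [Finset.sum_union hd, Finset.sum_add_distrib]
  rw [e1, e2, e3, e4, e5, e6, z1, z2, z3, z4, z5, z6, z7, z8]
  unfold occPoint occPair
  ring

theorem inc_insert (hfT : ∀ p ∈ T, f p ∈ T) (hfI : ∀ q ∈ I, f q ∈ I)
    (hlo : ∀ p ∈ T, ∀ q ∈ I, lo p → p < q) (hhi : ∀ p ∈ T, ∀ q ∈ I, ¬ lo p → q < p) :
    inc (T ∪ I) f = inc T f + I.card * incPoint T f lo + inc I f := by
  classical
  have hd := disjoint_of_side hlo hhi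
  have lt_iff : ∀ p ∈ T, ∀ q ∈ I, (p < q ↔ lo p) := fun p hp q hq =>
    ⟨fun h => by_contra fun h' => lt_asymm h (hhi p hp q hq h'), hlo p hp q hq⟩
  have gt_iff : ∀ p ∈ T, ∀ q ∈ I, (q < p ↔ ¬ lo p) := fun p hp q hq =>
    ⟨fun h h' => lt_asymm h (hlo p hp q hq h'), hhi p hp q hq⟩
  have e1 : ∑ a ∈ T, ∑ b ∈ I, (if a < b ∧ f a < f b then 1 else 0) =
      I.card * ∑ a ∈ T, if lo a ∧ lo (f a) then 1 else 0 := by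
    rw [Finset.sum_comm, ← smul_eq_mul, ← Finset.sum_const]
    refine sum_congr_two fun b hb a ha => ?_
    simp only [lt_iff a ha b hb, lt_iff _ (hfT a ha) _ (hfI b hb)]
  have e2 : ∑ a ∈ I, ∑ b ∈ T, (if a < b ∧ f a < f b then 1 else 0) =
      I.card * ∑ b ∈ T, if ¬ lo b ∧ ¬ lo (f b) then 1 else 0 := by
    rw [← smul_eq_mul, ← Finset.sum_const]
    refine sum_congr_two fun a ha b hb => ?_
    simp only [gt_iff b hb a ha, gt_iff _ (hfT b hb) _ (hfI a ha)]
  unfold inc incPoint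
  simp only [Finset.sum_union hd, Finset.sum_add_distrib]
  rw [e1, e2]
  ring

end Insert

end InvolutionPattern

/-! ### Involutions of finite linear orders -/

open InvolutionPattern

/-- An involution of `{0, …, size - 1}`, extended to `ℕ` by the identity. -/
@[ext]
structure FinInvolution where
  size : ℕ
  toFun : ℕ → ℕ
  involutive : Function.Involutive toFun
  fixes : ∀ k, size ≤ k → toFun k = k

namespace FinInvolution

instance : CoeFun FinInvolution fun _ => ℕ → ℕ := ⟨toFun⟩

variable {α β : Type*} [LinearOrder α] [LinearOrder β]

theorem apply_apply (a : FinInvolution) (k : ℕ) : a (a k) = k := a.involutive k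

theorem apply_lt (a : FinInvolution) {k : ℕ} (h : k < a.size) : a k < a.size := by
  by_contra h'
  have := a.fixes (a k) (not_lt.1 h')
  rw [a.apply_apply] at this
  omega

theorem apply_mem_range (a : FinInvolution) : ∀ k ∈ Finset.range a.size, a k ∈ Finset.range a.size :=
  fun _ h => Finset.mem_range.2 (a.apply_lt (Finset.mem_range.1 h))

/-- `a` is the standardization of the restriction of `f` to the invariant set `S`. -/
def Represents (a : FinInvolution) (S : Finset α) (f : α → α) : Prop :=
  ∃ e : ℕ → α, StrictMonoOn e (Finset.range a.size : Set ℕ) ∧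
    (Finset.range a.size).image e = S ∧ ∀ k < a.size, f (e k) = e (a k)

/-- A finite set has only one increasing enumeration; this makes the standardization unique. -/
theorem enum_unique {S : Finset α} {m n : ℕ} {e e' : ℕ → α}
    (he : StrictMonoOn e (Finset.range m : Set ℕ)) (hS : (Finset.range m).image e = S)
    (he' : StrictMonoOn e' (Finset.range n : Set ℕ)) (hS' : (Finset.range n).image e' = S) :
    m = n ∧ ∀ k < m, e k = e' k := by
  have c1 : S.card = m := by rw [← hS, Finset.card_image_of_injOn he.injOn, Finset.card_range]
  have c2 : S.card = n := by rw [← hS', Finset.card_image_of_injOn he'.injOn, Finset.card_range]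
  obtain rfl : m = n := c1.symm.trans c2
  refine ⟨rfl, fun k hk => ?_⟩
  have key : ∀ e : ℕ → α, StrictMonoOn e (Finset.range m : Set ℕ) →
      (Finset.range m).image e = S → (fun i : Fin m => e i) = S.orderEmbOfFin c1 := by
    intro e he hS
    refine Finset.orderEmbOfFin_unique c1 (fun i => ?_) fun i j hij => ?_
    · rw [← hS]
      exact Finset.mem_image_of_mem _ (Finset.mem_range.2 i.2)
    · exact he (by simp) (by simp) hij
  exact congrFun ((key e he hS).trans (key e' he' hS').symm) ⟨k, hk⟩

theorem Represents.unique {a b : FinInvolution} {S : Finset α} {f : α → α}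
    (ha : a.Represents S f) (hb : b.Represents S f) : a = b := by
  obtain ⟨e, he, hS, hf⟩ := ha
  obtain ⟨e', he', hS', hf'⟩ := hb
  obtain ⟨hn, hee⟩ := enum_unique he hS he' hS'
  refine FinInvolution.ext hn (funext fun k => ?_)
  rcases lt_or_ge k a.size with hk | hk
  · have hk' : k < b.size := hn ▸ hk
    refine he.injOn (by simpa using a.apply_lt hk) (by simpa [hn] using b.apply_lt hk') ?_
    rw [← hf k hk, hee k hk, hf' k hk', hee _ (by rw [hn]; exact b.apply_lt hk')]
  · rw [a.fixes k hk, b.fixes k (hn ▸ hk)]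

theorem represents_self (a : FinInvolution) : a.Represents (Finset.range a.size) a :=
  ⟨id, strictMonoOn_id, by simp, fun _ _ => rfl⟩

theorem Represents.image {a : FinInvolution} {S : Finset α} {f : α → α} {g : β → β} {h : α → β}
    (ha : a.Represents S f) (hh : StrictMonoOn h S) (hg : ∀ x ∈ S, g (h x) = h (f x)) :
    a.Represents (S.image h) g := by
  obtain ⟨e, he, rfl, hf⟩ := ha
  have hmem : ∀ k ∈ Finset.range a.size, e k ∈ (Finset.range a.size).image e :=
    fun k hk => Finset.mem_image_of_mem _ hk
  refine ⟨h ∘ e, fun i hi j hj hij => hh (hmem i hi) (hmem j hj) (he hi hj hij),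
    Finset.image_image.symm, fun k hk => ?_⟩
  simp only [Function.comp_apply]
  rw [hg _ (hmem k (Finset.mem_range.2 hk)), hf k hk]

theorem Represents.of_image [Nonempty α] {a : FinInvolution} {S : Finset α} {f : α → α} {g : β → β} {h : α → β}
    (ha : a.Represents (S.image h) g) (hh : StrictMonoOn h S) (hS : ∀ x ∈ S, f x ∈ S)
    (hg : ∀ x ∈ S, g (h x) = h (f x)) : a.Represents S f := by
  obtain ⟨d, hd, hdS, hdf⟩ := ha
  have hmem : ∀ k < a.size, ∃ p ∈ S, h p = d k := fun k hk =>
    Finset.mem_image.1 (hdS ▸ Finset.mem_image_of_mem d (Finset.mem_range.2 hk))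
  choose! p hp hep using hmem
  refine ⟨p, fun i hi l hl hil => ?_, ?_, fun k hk => ?_⟩
  · have hi' : i < a.size := by simpa using hi
    have hl' : l < a.size := by simpa using hl
    refine (hh.lt_iff_lt (hp i hi') (hp l hl')).1 ?_
    rw [hep i hi', hep l hl']
    exact hd hi hl hil
  · ext q
    constructor
    · intro hq
      obtain ⟨k, hk, rfl⟩ := Finset.mem_image.1 hq
      exact hp k (Finset.mem_range.1 hk)
    · intro hq
      have : h q ∈ (Finset.range a.size).image d := by
        rw [hdS]
        exact Finset.mem_image_of_mem h hq
      obtain ⟨k, hk, hkq⟩ := Finset.mem_image.1 this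
      refine Finset.mem_image.2 ⟨k, hk, ?_⟩
      have hk' := Finset.mem_range.1 hk
      exact hh.injOn (hp k hk') hq (by rw [hep k hk', hkq])
  · refine hh.injOn (hS _ (hp k hk)) (hp _ (a.apply_lt hk)) ?_
    rw [← hg _ (hp k hk), hep k hk, hdf k hk, hep _ (a.apply_lt hk)]

theorem exists_represents [Nonempty α] {S : Finset α} {f : α → α} (hS : ∀ x ∈ S, f x ∈ S)
    (hf : ∀ x ∈ S, f (f x) = x) : ∃ a : FinInvolution, a.Represents S f := by
  set s := S.orderIsoOfFin rfl with hs
  let F : S → S := fun x => ⟨f x, hS x x.2⟩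
  have hF : ∀ x, F (F x) = x := fun x => Subtype.ext (hf x x.2)
  let g : ℕ → ℕ := fun k => if h : k < S.card then s.symm (F (s ⟨k, h⟩)) else k
  have hg : ∀ k (h : k < S.card), g k = s.symm (F (s ⟨k, h⟩)) := fun k h => dif_pos h
  have hglt : ∀ k, k < S.card → g k < S.card := fun k h => by rw [hg k h]; exact Fin.is_lt _
  refine ⟨⟨S.card, g, fun k => ?_, fun k hk => dif_neg (not_lt.2 hk)⟩, ?_⟩
  · by_cases h : k < S.card
    · rw [hg _ (hglt k h)]
      have : (⟨g k, hglt k h⟩ : Fin S.card) = s.symm (F (s ⟨k, h⟩)) := Fin.ext (hg k h)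
      rw [this, OrderIso.apply_symm_apply, hF, OrderIso.symm_apply_apply]
    · have : g k = k := dif_neg h
      rw [this, this]
  · let e : ℕ → α := fun k => if h : k < S.card then (s ⟨k, h⟩ : α) else Classical.arbitrary α
    have he : ∀ k (h : k < S.card), e k = s ⟨k, h⟩ := fun k h => dif_pos h
    refine ⟨e, fun i hi j hj hij => ?_, ?_, fun k hk => ?_⟩
    · rw [he i (by simpa using hi), he j (by simpa using hj)]
      exact s.strictMono hij
    · ext x
      simp only [Finset.mem_image, Finset.mem_range]
      constructor
      · rintro ⟨k, hk, rfl⟩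
        rw [he k hk]
        exact Subtype.prop _
      · intro hx
        refine ⟨s.symm ⟨x, hx⟩, Fin.is_lt _, ?_⟩
        rw [he _ (Fin.is_lt _)]
        simp
    · change f (e k) = e (g k)
      rw [he _ (hglt k hk), he k hk]
      have : (⟨g k, hglt k hk⟩ : Fin S.card) = s.symm (F (s ⟨k, hk⟩)) := Fin.ext (hg k hk)
      rw [this, OrderIso.apply_symm_apply]

section Stats

variable {a : FinInvolution} {S : Finset α} {f : α → α}

theorem Represents.occ_eq (h : a.Represents S f) : occ S f = occ (Finset.range a.size) a := by
  obtain ⟨e, he, rfl, hf⟩ := h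
  exact occ_image he a.apply_mem_range fun x hx => hf x (Finset.mem_range.1 hx)

theorem Represents.inc_eq (h : a.Represents S f) : inc S f = inc (Finset.range a.size) a := by
  obtain ⟨e, he, rfl, hf⟩ := h
  exact inc_image he a.apply_mem_range fun x hx => hf x (Finset.mem_range.1 hx)

theorem Represents.arcs_eq (h : a.Represents S f) : arcs S f = arcs (Finset.range a.size) a := by
  obtain ⟨e, he, rfl, hf⟩ := h
  exact arcs_image he a.apply_mem_range fun x hx => hf x (Finset.mem_range.1 hx)

theorem Represents.card_eq (h : a.Represents S f) : S.card = a.size := by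
  obtain ⟨e, he, rfl, hf⟩ := h
  rw [Finset.card_image_of_injOn he.injOn, Finset.card_range]

end Stats

end FinInvolution

/-! ### The core of an involution -/

namespace InvolutionPattern

variable {α β : Type*} [LinearOrder α] [LinearOrder β]

/-- An invariant interval of `S` that lies above some point of `S`. -/
structure IsBlock (S : Finset α) (f : α → α) (I : Finset α) : Prop where
  subset : I ⊆ S
  closed : ∀ x ∈ I, f x ∈ I
  interval : ∀ x ∈ I, ∀ y ∈ I, ∀ z ∈ S, x ≤ z → z ≤ y → z ∈ I
  above : ∃ s ∈ S, ∀ x ∈ I, s < x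

open Classical in
/-- The points of `S` that lie in no block. -/
noncomputable def core (S : Finset α) (f : α → α) : Finset α :=
  S.filter fun p => ∀ I, IsBlock S f I → p ∉ I

open Classical in
/-- The points of `S` between the core point `c` and the next core point. -/
noncomputable def gap (S : Finset α) (f : α → α) (c : α) : Finset α :=
  S.filter fun p => c < p ∧ ∀ c' ∈ core S f, c' ≤ p → c' ≤ c

theorem mem_core {S : Finset α} {f : α → α} {p : α} :
    p ∈ core S f ↔ p ∈ S ∧ ∀ I, IsBlock S f I → p ∉ I := by
  simp [core]

theorem mem_gap {S : Finset α} {f : α → α} {c p : α} :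
    p ∈ gap S f c ↔ p ∈ S ∧ c < p ∧ ∀ c' ∈ core S f, c' ≤ p → c' ≤ c := by
  simp [gap]

theorem core_subset (S : Finset α) (f : α → α) : core S f ⊆ S := by
  classical
  exact Finset.filter_subset _ _

theorem gap_subset (S : Finset α) (f : α → α) (c : α) : gap S f c ⊆ S := by
  classical
  exact Finset.filter_subset _ _

/-! ### Blocks, cores and gaps under increasing relabelling -/

section Image

variable {S : Finset α} {f : α → α} {g : β → β} {e : α → β}

theorem isBlock_image (he : StrictMonoOn e S) (h : ∀ x ∈ S, g (e x) = e (f x)) {I : Finset α}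
    (hI : IsBlock S f I) : IsBlock (S.image e) g (I.image e) where
  subset := Finset.image_subset_image hI.subset
  closed := by
    simp only [Finset.forall_mem_image]
    intro x hx
    rw [h x (hI.subset hx)]
    exact Finset.mem_image_of_mem _ (hI.closed x hx)
  interval := by
    simp only [Finset.forall_mem_image]
    intro x hx y hy z hz hxz hzy
    exact Finset.mem_image_of_mem _ (hI.interval x hx y hy z hz
      ((he.le_iff_le (hI.subset hx) hz).1 hxz) ((he.le_iff_le hz (hI.subset hy)).1 hzy))
  above := by
    obtain ⟨s, hs, h⟩ := hI.above
    refine ⟨e s, Finset.mem_image_of_mem _ hs, ?_⟩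
    simp only [Finset.forall_mem_image]
    exact fun x hx => he hs (hI.subset hx) (h x hx)

theorem isBlock_preimage (he : StrictMonoOn e S) (hf : ∀ x ∈ S, f x ∈ S)
    (h : ∀ x ∈ S, g (e x) = e (f x)) {I : Finset β}
    (hI : IsBlock (S.image e) g I) : IsBlock S f (S.filter fun x => e x ∈ I) where
  subset := Finset.filter_subset _ _
  closed := by
    simp only [Finset.mem_filter]
    rintro x ⟨hx, hxI⟩
    exact ⟨hf x hx, h x hx ▸ hI.closed _ hxI⟩
  interval := by
    simp only [Finset.mem_filter]
    rintro x ⟨hx, hxI⟩ y ⟨hy, hyI⟩ z hz hxz hzy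
    exact ⟨hz, hI.interval _ hxI _ hyI _ (Finset.mem_image_of_mem _ hz)
      ((he.le_iff_le hx hz).2 hxz) ((he.le_iff_le hz hy).2 hzy)⟩
  above := by
    obtain ⟨t, ht, h⟩ := hI.above
    obtain ⟨s, hs, rfl⟩ := Finset.mem_image.1 ht
    refine ⟨s, hs, fun x hx => ?_⟩
    rw [Finset.mem_filter] at hx
    exact (he.lt_iff_lt hs hx.1).1 (h _ hx.2)

theorem mem_core_image (he : StrictMonoOn e S) (hf : ∀ x ∈ S, f x ∈ S)
    (h : ∀ x ∈ S, g (e x) = e (f x)) {p : α} (hp : p ∈ S) :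
    e p ∈ core (S.image e) g ↔ p ∈ core S f := by
  rw [mem_core, mem_core]
  refine ⟨fun hc => ⟨hp, fun I hI hpI => ?_⟩, fun hc => ⟨Finset.mem_image_of_mem _ hp,
    fun I hI hpI => ?_⟩⟩
  · exact hc.2 _ (isBlock_image he h hI) (Finset.mem_image_of_mem _ hpI)
  · exact hc.2 _ (isBlock_preimage he hf h hI) (Finset.mem_filter.2 ⟨hp, hpI⟩)

theorem core_image (he : StrictMonoOn e S) (hf : ∀ x ∈ S, f x ∈ S)
    (h : ∀ x ∈ S, g (e x) = e (f x)) : core (S.image e) g = (core S f).image e := by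
  ext y
  rw [Finset.mem_image]
  constructor
  · intro hy
    obtain ⟨x, hx, rfl⟩ := Finset.mem_image.1 (core_subset _ _ hy)
    exact ⟨x, (mem_core_image he hf h hx).1 hy, rfl⟩
  · rintro ⟨x, hx, rfl⟩
    exact (mem_core_image he hf h (core_subset _ _ hx)).2 hx

theorem gap_image (he : StrictMonoOn e S) (hf : ∀ x ∈ S, f x ∈ S)
    (h : ∀ x ∈ S, g (e x) = e (f x)) {c : α} (hc : c ∈ S) :
    gap (S.image e) g (e c) = (gap S f c).image e := by
  ext y
  simp only [mem_gap, Finset.mem_image, core_image he hf h]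
  constructor
  · rintro ⟨⟨x, hx, rfl⟩, hcx, h'⟩
    refine ⟨x, ⟨hx, (he.lt_iff_lt hc hx).1 hcx, fun c' hc' hc'x => ?_⟩, rfl⟩
    have hc'S := core_subset _ _ hc'
    exact (he.le_iff_le hc'S hc).1 (h' _ ⟨c', hc', rfl⟩ ((he.le_iff_le hc'S hx).2 hc'x))
  · rintro ⟨x, ⟨hx, hcx, h'⟩, rfl⟩
    refine ⟨⟨x, hx, rfl⟩, he hc hx hcx, ?_⟩
    rintro _ ⟨c', hc', rfl⟩ hc'x
    have hc'S := core_subset _ _ hc'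
    exact (he.le_iff_le hc'S hc).2 (h' c' hc' ((he.le_iff_le hc'S hx).1 hc'x))

end Image

/-! ### Invariance of the core and of the gaps -/

section Closed

variable {S : Finset α} {f : α → α}

theorem core_closed (hS : ∀ x ∈ S, f x ∈ S) (hf : ∀ x ∈ S, f (f x) = x) {p : α}
    (hp : p ∈ core S f) : f p ∈ core S f := by
  rw [mem_core] at hp ⊢
  refine ⟨hS p hp.1, fun I hI hpI => hp.2 I hI ?_⟩
  rw [← hf p hp.1]
  exact hI.closed _ hpI

theorem exists_block {p : α} (hp : p ∈ S) (h : p ∉ core S f) : ∃ I, IsBlock S f I ∧ p ∈ I := by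
  rw [mem_core] at h
  push Not at h
  exact h hp

theorem notMem_core_of_mem_gap {c p : α} (hp : p ∈ gap S f c) : p ∉ core S f := fun h =>
  not_lt.2 ((mem_gap.1 hp).2.2 p h le_rfl) (mem_gap.1 hp).2.1

/-- A point of a gap lies in some block. The block contains its image as well and no core point, so
no core point separates the two. -/
theorem gap_closed (hS : ∀ x ∈ S, f x ∈ S) {c p : α} (hc : c ∈ core S f)
    (hp : p ∈ gap S f c) : f p ∈ gap S f c := by
  obtain ⟨I, hI, hpI⟩ := exists_block (gap_subset _ _ _ hp) (notMem_core_of_mem_gap hp)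
  have hfp := hI.closed p hpI
  rw [mem_gap] at hp ⊢
  have hcI : ∀ c' ∈ core S f, c' ∉ I := fun c' hc' => (mem_core.1 hc').2 I hI
  refine ⟨hS p hp.1, ?_, fun c' hc' hc'p => ?_⟩
  · by_contra h
    exact hcI c hc (hI.interval _ hfp _ hpI c (core_subset _ _ hc) (not_lt.1 h) hp.2.1.le)
  · by_contra h
    have h1 : p < c' := by
      by_contra h2
      exact h (hp.2.2 c' hc' (not_lt.1 h2))
    exact hcI c' hc' (hI.interval _ hpI _ hfp c' (core_subset _ _ hc') h1.le hc'p)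

theorem min_mem_core (hne : S.Nonempty) : S.min' hne ∈ core S f := by
  rw [mem_core]
  refine ⟨S.min'_mem hne, fun I hI h => ?_⟩
  obtain ⟨s, hs, h'⟩ := hI.above
  exact not_lt.2 (S.min'_le s hs) (h' _ h)

/-- The head of `p` is the greatest core point not exceeding `p`. It exists because the least point
of `S` is in the core. -/
theorem exists_head {p : α} (hp : p ∈ S) : ∃ c ∈ core S f, p = c ∨ p ∈ gap S f c := by
  have hne : ((core S f).filter (· ≤ p)).Nonempty :=
    ⟨S.min' ⟨p, hp⟩, Finset.mem_filter.2 ⟨min_mem_core _, S.min'_le p hp⟩⟩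
  set c := ((core S f).filter (· ≤ p)).max' hne with hc
  have hcm := Finset.mem_filter.1 (Finset.max'_mem _ hne)
  rw [← hc] at hcm
  refine ⟨c, hcm.1, ?_⟩
  rcases hcm.2.eq_or_lt with h | h
  · exact Or.inl h.symm
  · exact Or.inr (mem_gap.2 ⟨hp, h, fun c' hc' hc'p =>
      Finset.le_max' _ _ (Finset.mem_filter.2 ⟨hc', hc'p⟩)⟩)

/-- Points with smaller head are smaller. -/
theorem head_lt {c c' p p' : α} (hc' : c' ∈ core S f)
    (hp : p = c ∨ p ∈ gap S f c) (hp' : p' = c' ∨ p' ∈ gap S f c') (h : c < c') : p < p' := by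
  have h1 : p < c' := by
    rcases hp with rfl | hp
    · exact h
    · by_contra h'
      exact not_lt.2 ((mem_gap.1 hp).2.2 c' hc' (not_lt.1 h')) h
  have h2 : c' ≤ p' := by
    rcases hp' with rfl | hp'
    · exact le_rfl
    · exact (mem_gap.1 hp').2.1.le
  exact h1.trans_le h2

/-- A block of the core, enlarged by the gaps after its points, is a block of `S`; but core points
lie in no block of `S`. So the core is primitive. -/
theorem isBlock_core_eq_empty (hS : ∀ x ∈ S, f x ∈ S) {J : Finset α}
    (hJ : IsBlock (core S f) f J) : J = ∅ := by
  classical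
  by_contra hne
  obtain ⟨x0, hx0⟩ := Finset.nonempty_iff_ne_empty.2 hne
  have hle : ∀ {c c' p p' : α}, c ∈ core S f → (p = c ∨ p ∈ gap S f c) →
      (p' = c' ∨ p' ∈ gap S f c') → p ≤ p' → c ≤ c' := fun hc hp hp' h => by
    by_contra h'
    exact not_lt.2 h (head_lt hc hp' hp (not_le.1 h'))
  have hB : IsBlock S f (S.filter fun p => ∃ c ∈ J, p = c ∨ p ∈ gap S f c) := by
    refine ⟨Finset.filter_subset _ _, ?_, ?_, ?_⟩
    · simp only [Finset.mem_filter]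
      rintro p ⟨hp, c, hc, h⟩
      refine ⟨hS p hp, ?_⟩
      rcases h with rfl | h
      · exact ⟨f p, hJ.closed p hc, Or.inl rfl⟩
      · exact ⟨c, hc, Or.inr (gap_closed hS (hJ.subset hc) h)⟩
    · simp only [Finset.mem_filter]
      rintro x ⟨hx, c, hc, hxc⟩ y ⟨hy, c', hc', hyc'⟩ z hz hxz hzy
      obtain ⟨d, hd, hzd⟩ := exists_head (f := f) hz
      exact ⟨hz, d, hJ.interval c hc c' hc' d hd (hle (hJ.subset hc) hxc hzd hxz)
        (hle hd hzd hyc' hzy), hzd⟩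
    · obtain ⟨s, hs, h⟩ := hJ.above
      refine ⟨s, core_subset _ _ hs, ?_⟩
      simp only [Finset.mem_filter]
      rintro x ⟨hx, c, hc, hxc⟩
      exact head_lt (hJ.subset hc) (Or.inl rfl) hxc (h c hc)
  have hx0c := hJ.subset hx0
  exact (mem_core.1 hx0c).2 _ hB
    (Finset.mem_filter.2 ⟨core_subset _ _ hx0c, x0, hx0, Or.inl rfl⟩)

end Closed

end InvolutionPattern

/-! ### Inserting involutions into the gaps of a primitive involution -/

namespace FinInvolution

/-- No nonempty block avoids the first point. -/
def IsPrimitive (κ : FinInvolution) : Prop :=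
  κ.size ≠ 0 ∧ ∀ I, IsBlock (Finset.range κ.size) κ I → I = ∅

/-- The points of the involution with vertices `(j, 0)` permuted by `κ` and a copy
`(j, 1), (j, 2), …` of `τ j` after the vertex `(j, 0)`. -/
def model (κ : FinInvolution) (τ : ℕ → FinInvolution) : Finset (ℕ ×ₗ ℕ) :=
  (Finset.range κ.size).biUnion fun j =>
    (Finset.range ((τ j).size + 1)).image fun k => toLex (j, k)

/-- The map of the involution with vertices `(j, 0)` permuted by `κ` and a copy
`(j, 1), (j, 2), …` of `τ j` after the vertex `(j, 0)`. -/
def modelMap (κ : FinInvolution) (τ : ℕ → FinInvolution) (p : ℕ ×ₗ ℕ) : ℕ ×ₗ ℕ :=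
  match (ofLex p).2 with
  | 0 => toLex (κ (ofLex p).1, 0)
  | k + 1 => toLex ((ofLex p).1, τ (ofLex p).1 k + 1)

variable (κ : FinInvolution) (τ : ℕ → FinInvolution)

@[simp] theorem modelMap_zero (j : ℕ) : modelMap κ τ (toLex (j, 0)) = toLex (κ j, 0) := rfl

@[simp] theorem modelMap_succ (j k : ℕ) :
    modelMap κ τ (toLex (j, k + 1)) = toLex (j, τ j k + 1) := rfl

@[simp] theorem mem_model {j k : ℕ} :
    toLex (j, k) ∈ model κ τ ↔ j < κ.size ∧ k ≤ (τ j).size := by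
  simp only [model, Finset.mem_biUnion, Finset.mem_range, Finset.mem_image, toLex_inj,
    Prod.mk.injEq]
  constructor
  · rintro ⟨i, hi, k', hk', rfl, rfl⟩
    exact ⟨hi, by omega⟩
  · rintro ⟨h1, h2⟩
    exact ⟨j, h1, k, by omega, rfl, rfl⟩

theorem exists_toLex (p : ℕ ×ₗ ℕ) : ∃ j k, p = toLex (j, k) := ⟨(ofLex p).1, (ofLex p).2, rfl⟩

theorem model_closed : ∀ p ∈ model κ τ, modelMap κ τ p ∈ model κ τ := by
  intro p hp
  obtain ⟨j, _ | k, rfl⟩ := exists_toLex p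
  · rw [mem_model] at hp
    simpa using κ.apply_lt hp.1
  · rw [mem_model] at hp
    rw [modelMap_succ, mem_model]
    exact ⟨hp.1, (τ j).apply_lt hp.2⟩

theorem modelMap_modelMap (p : ℕ ×ₗ ℕ) : modelMap κ τ (modelMap κ τ p) = p := by
  obtain ⟨j, _ | k, rfl⟩ := exists_toLex p
  · simp [apply_apply]
  · simp [apply_apply]

/-- The involution obtained from `κ` by inserting `τ j` after the `j`-th point. -/
noncomputable def assemble : FinInvolution :=
  (exists_represents (model_closed κ τ) fun p _ => modelMap_modelMap κ τ p).choose

theorem assemble_represents : (assemble κ τ).Represents (model κ τ) (modelMap κ τ) :=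
  (exists_represents (model_closed κ τ) fun p _ => modelMap_modelMap κ τ p).choose_spec

theorem toLex_lt {i j k l : ℕ} :
    (toLex (i, k) : ℕ ×ₗ ℕ) < toLex (j, l) ↔ i < j ∨ i = j ∧ k < l := Prod.Lex.toLex_lt_toLex

theorem toLex_le {i j k l : ℕ} :
    (toLex (i, k) : ℕ ×ₗ ℕ) ≤ toLex (j, l) ↔ i < j ∨ i = j ∧ k ≤ l := Prod.Lex.toLex_le_toLex

/-- The vertices of the model. -/
def vertices (n : ℕ) : Finset (ℕ ×ₗ ℕ) := (Finset.range n).image fun j => toLex (j, 0)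

/-- The points of the model inserted after the `j`-th vertex. -/
def inserted (n j : ℕ) : Finset (ℕ ×ₗ ℕ) := (Finset.range n).image fun k => toLex (j, k + 1)

@[simp] theorem mem_vertices {n j k : ℕ} : toLex (j, k) ∈ vertices n ↔ j < n ∧ k = 0 := by
  simp only [vertices, Finset.mem_image, Finset.mem_range, toLex_inj, Prod.mk.injEq]
  constructor
  · rintro ⟨i, hi, rfl, rfl⟩
    exact ⟨hi, rfl⟩
  · rintro ⟨h, rfl⟩
    exact ⟨j, h, rfl, rfl⟩

@[simp] theorem mem_inserted {n i j k : ℕ} :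
    toLex (i, k) ∈ inserted n j ↔ i = j ∧ k ≠ 0 ∧ k ≤ n := by
  simp only [inserted, Finset.mem_image, Finset.mem_range, toLex_inj, Prod.mk.injEq]
  constructor
  · rintro ⟨l, hl, rfl, rfl⟩
    exact ⟨rfl, by omega, by omega⟩
  · rintro ⟨rfl, h1, h2⟩
    exact ⟨k - 1, by omega, rfl, by omega⟩

theorem vertices_strictMono (n : ℕ) :
    StrictMonoOn (fun j => (toLex (j, 0) : ℕ ×ₗ ℕ)) (Finset.range n : Set ℕ) :=
  fun _ _ _ _ h => toLex_lt.2 (Or.inl h)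

theorem inserted_strictMono (n j : ℕ) :
    StrictMonoOn (fun k => (toLex (j, k + 1) : ℕ ×ₗ ℕ)) (Finset.range n : Set ℕ) :=
  fun _ _ _ _ h => toLex_lt.2 (Or.inr ⟨rfl, Nat.succ_lt_succ h⟩)

theorem represents_vertices : κ.Represents (vertices κ.size) (modelMap κ τ) :=
  ⟨_, vertices_strictMono _, rfl, fun _ _ => rfl⟩

theorem represents_inserted (j : ℕ) :
    (τ j).Represents (inserted (τ j).size j) (modelMap κ τ) :=
  ⟨_, inserted_strictMono _ _, rfl, fun _ _ => rfl⟩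

/-- The vertex `(j, 0)` is the lower point required of a block. This is why involutions are inserted
after the points of a core and never before the first one. -/
theorem isBlock_inserted {j : ℕ} (hj : j < κ.size) :
    IsBlock (model κ τ) (modelMap κ τ) (inserted (τ j).size j) where
  subset p hp := by
    obtain ⟨i, k, rfl⟩ := exists_toLex p
    obtain ⟨rfl, h1, h2⟩ := mem_inserted.1 hp
    exact (mem_model _ _).2 ⟨hj, h2⟩
  closed p hp := by
    obtain ⟨i, _ | k, rfl⟩ := exists_toLex p
    · simp at hp
    · obtain ⟨rfl, h1, h2⟩ := mem_inserted.1 hp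
      rw [modelMap_succ, mem_inserted]
      exact ⟨rfl, by omega, (τ i).apply_lt h2⟩
  interval x hx y hy z hz hxz hzy := by
    obtain ⟨i, k, rfl⟩ := exists_toLex x
    obtain ⟨i', k', rfl⟩ := exists_toLex y
    obtain ⟨l, m, rfl⟩ := exists_toLex z
    rw [mem_inserted] at *
    rw [toLex_le] at *
    rw [mem_model] at hz
    obtain ⟨rfl, h1, h2⟩ := hx
    obtain ⟨rfl, h3, h4⟩ := hy
    have : l = i' := by omega
    subst this
    exact ⟨rfl, by omega, hz.2⟩
  above := by
    refine ⟨toLex (j, 0), by simpa using hj, fun p hp => ?_⟩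
    obtain ⟨i, k, rfl⟩ := exists_toLex p
    obtain ⟨rfl, h1, h2⟩ := mem_inserted.1 hp
    rw [toLex_lt]
    omega

/-- The inserted copies are blocks, so only vertices can be in the core. Conversely, the vertices
contained in a block of the model form a block of `κ`, which is empty by primitivity. -/
theorem core_model (hκ : κ.IsPrimitive) : core (model κ τ) (modelMap κ τ) = vertices κ.size := by
  classical
  ext p
  obtain ⟨j, k, rfl⟩ := exists_toLex p
  rw [mem_vertices, mem_core, mem_model]
  constructor
  · rintro ⟨⟨hj, hk⟩, h⟩
    refine ⟨hj, ?_⟩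
    by_contra hk0
    exact h _ (isBlock_inserted κ τ hj) (mem_inserted.2 ⟨rfl, hk0, hk⟩)
  · rintro ⟨hj, rfl⟩
    refine ⟨⟨hj, Nat.zero_le _⟩, fun I hI hjI => ?_⟩
    have hB : IsBlock (Finset.range κ.size) κ
        ((Finset.range κ.size).filter fun i => (toLex (i, 0) : ℕ ×ₗ ℕ) ∈ I) := by
      refine ⟨Finset.filter_subset _ _, ?_, ?_, ?_⟩
      · simp only [Finset.mem_filter, Finset.mem_range]
        rintro x ⟨hx, hxI⟩
        exact ⟨κ.apply_lt hx, hI.closed _ hxI⟩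
      · simp only [Finset.mem_filter, Finset.mem_range]
        rintro x ⟨hx, hxI⟩ y ⟨hy, hyI⟩ z hz hxz hzy
        refine ⟨hz, hI.interval _ hxI _ hyI _ (by simpa using hz) ?_ ?_⟩ <;> rw [toLex_le] <;> omega
      · obtain ⟨s, hs, h⟩ := hI.above
        obtain ⟨i, k, rfl⟩ := exists_toLex s
        rw [mem_model] at hs
        refine ⟨i, Finset.mem_range.2 hs.1, ?_⟩
        simp only [Finset.mem_filter, Finset.mem_range]
        rintro x ⟨hx, hxI⟩
        have := h _ hxI
        rw [toLex_lt] at this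
        omega
    have := hκ.2 _ hB
    exact Finset.notMem_empty j (this ▸ Finset.mem_filter.2 ⟨Finset.mem_range.2 hj, hjI⟩)

theorem gap_model (hκ : κ.IsPrimitive) {j : ℕ} (hj : j < κ.size) :
    gap (model κ τ) (modelMap κ τ) (toLex (j, 0)) = inserted (τ j).size j := by
  ext p
  obtain ⟨i, k, rfl⟩ := exists_toLex p
  rw [mem_gap, core_model κ τ hκ, mem_inserted, mem_model, toLex_lt]
  constructor
  · rintro ⟨⟨hi, hk⟩, h, h'⟩
    have := h' (toLex (i, 0)) (mem_vertices.2 ⟨hi, rfl⟩) (toLex_le.2 (by omega))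
    rw [toLex_le] at this
    have hij : i = j := by omega
    subst hij
    exact ⟨rfl, by omega, hk⟩
  · rintro ⟨rfl, h1, h2⟩
    refine ⟨⟨hj, h2⟩, by omega, fun c' hc' h => ?_⟩
    obtain ⟨l, m, rfl⟩ := exists_toLex c'
    rw [mem_vertices] at hc'
    rw [toLex_le] at *
    omega

/-! ### Unique decomposition of an involution into core and gaps -/

section Represents

variable {κ τ}

/-- `κ` is the standardization of the core of `a`. -/
def HasCore (a κ : FinInvolution) : Prop := κ.Represents (core (Finset.range a.size) a) a

theorem HasCore.unique {a κ κ' : FinInvolution} (h : a.HasCore κ) (h' : a.HasCore κ') : κ = κ' :=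
  Represents.unique h h'

theorem hasCore_assemble (hκ : κ.IsPrimitive) : (assemble κ τ).HasCore κ := by
  obtain ⟨e, he, hS, hf⟩ := assemble_represents κ τ
  set a := assemble κ τ
  have hf' : ∀ x ∈ Finset.range a.size, modelMap κ τ (e x) = e (a x) :=
    fun x hx => hf x (Finset.mem_range.1 hx)
  have hv := represents_vertices κ τ
  rw [← core_model κ τ hκ, ← hS, core_image he a.apply_mem_range hf'] at hv
  exact hv.of_image (he.mono (core_subset _ _))
    (fun x hx => core_closed a.apply_mem_range (fun x _ => a.apply_apply x) hx)
    fun x hx => hf' x (core_subset _ _ hx)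

/-- The inserted involutions can be recovered from the gaps. -/
theorem represents_gap_assemble (hκ : κ.IsPrimitive) {c : ℕ → ℕ}
    (hc : StrictMonoOn c (Finset.range κ.size : Set ℕ))
    (hcS : (Finset.range κ.size).image c =
      core (Finset.range (assemble κ τ).size) (assemble κ τ)) {j : ℕ} (hj : j < κ.size) :
    (τ j).Represents (gap (Finset.range (assemble κ τ).size) (assemble κ τ) (c j))
      (assemble κ τ) := by
  obtain ⟨e, he, hS, hf⟩ := assemble_represents κ τ
  set a := assemble κ τ
  have hf' : ∀ x ∈ Finset.range a.size, modelMap κ τ (e x) = e (a x) :=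
    fun x hx => hf x (Finset.mem_range.1 hx)
  have hcc : ∀ k < κ.size, c k ∈ core (Finset.range a.size) a := fun k hk =>
    hcS ▸ Finset.mem_image_of_mem c (Finset.mem_range.2 hk)
  have hcr : ∀ k < κ.size, c k ∈ Finset.range a.size := fun k hk => core_subset _ _ (hcc k hk)
  -- `e ∘ c` and `k ↦ (k, 0)` are both increasing enumerations of the vertices, hence equal.
  have hec : ∀ k < κ.size, e (c k) = toLex (k, 0) := by
    refine (enum_unique (e := e ∘ c) (m := κ.size) (fun i hi j hj hij => ?_) ?_
      (vertices_strictMono κ.size) (rfl : _ = vertices κ.size)).2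
    · exact he (hcr i (by simpa using hi)) (hcr j (by simpa using hj)) (hc hi hj hij)
    · rw [← Finset.image_image, hcS, ← core_image he a.apply_mem_range hf', hS,
        core_model κ τ hκ]
  have hg := represents_inserted κ τ j
  rw [← gap_model κ τ hκ hj, ← hec j hj, ← hS, gap_image he a.apply_mem_range hf' (hcr j hj)] at hg
  exact hg.of_image (he.mono (gap_subset _ _ _))
    (fun x hx => gap_closed a.apply_mem_range (hcc j hj) hx)
    fun x hx => hf' x (gap_subset _ _ _ hx)

theorem assemble_injective (hκ : κ.IsPrimitive) {τ τ' : ℕ → FinInvolution}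
    (h : assemble κ τ = assemble κ τ') {j : ℕ} (hj : j < κ.size) : τ j = τ' j := by
  obtain ⟨c, hc, hcS, -⟩ := hasCore_assemble (τ := τ) hκ
  have h1 := represents_gap_assemble hκ hc hcS hj
  rw [h] at h1 hcS
  exact h1.unique (represents_gap_assemble hκ hc hcS hj)

theorem exists_hasCore {a : FinInvolution} (ha : a.size ≠ 0) :
    ∃ κ, κ.IsPrimitive ∧ a.HasCore κ := by
  have hinv : ∀ x ∈ Finset.range a.size, a (a x) = x := fun x _ => a.apply_apply x
  have hcl : ∀ x ∈ core (Finset.range a.size) a, a x ∈ core (Finset.range a.size) a :=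
    fun x hx => core_closed a.apply_mem_range hinv hx
  obtain ⟨κ, hκ⟩ := exists_represents hcl fun x _ => a.apply_apply x
  refine ⟨κ, ⟨?_, fun I hI => ?_⟩, hκ⟩
  · rw [← hκ.card_eq, Finset.card_ne_zero]
    exact ⟨_, min_mem_core ⟨0, by simpa using Nat.pos_of_ne_zero ha⟩⟩
  · obtain ⟨e, he, hS, hf⟩ := hκ
    have := isBlock_image he (fun x hx => hf x (Finset.mem_range.1 hx)) hI
    rw [hS] at this
    simpa using isBlock_core_eq_empty a.apply_mem_range this

/-- Take for `τ j` the standardization of the gap after the `j`-th core point. Sending vertices to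
core points and inserted copies to gaps maps the model to `a`: increasingly by `head_lt`, onto by
`exists_head`. -/
theorem exists_assemble_eq {a : FinInvolution} (h : a.HasCore κ) :
    ∃ τ, assemble κ τ = a := by
  have hinv : ∀ x ∈ Finset.range a.size, a (a x) = x := fun x _ => a.apply_apply x
  set S := Finset.range a.size with hSdef
  obtain ⟨c, hc, hcS, hcf⟩ := h
  have hcc : ∀ k < κ.size, c k ∈ core S a := fun k hk =>
    hcS ▸ Finset.mem_image_of_mem c (Finset.mem_range.2 hk)
  have hgap : ∀ j < κ.size, ∃ t : FinInvolution, t.Represents (gap S a (c j)) a := fun j hj =>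
    exists_represents (fun x hx => gap_closed a.apply_mem_range (hcc j hj) hx)
      fun x _ => a.apply_apply x
  have : Nonempty FinInvolution := ⟨a⟩
  choose! τ hτ using hgap
  choose! e he heS hef using hτ
  have heg : ∀ j < κ.size, ∀ k < (τ j).size, e j k ∈ gap S a (c j) := fun j hj k hk =>
    heS j hj ▸ Finset.mem_image_of_mem _ (Finset.mem_range.2 hk)
  let h : ℕ ×ₗ ℕ → ℕ := fun p =>
    match (ofLex p).2 with
    | 0 => c (ofLex p).1
    | k + 1 => e (ofLex p).1 k
  have h0 : ∀ j, h (toLex (j, 0)) = c j := fun _ => rfl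
  have h1 : ∀ j k, h (toLex (j, k + 1)) = e j k := fun _ _ => rfl
  have hhead : ∀ j k, toLex (j, k) ∈ model κ τ →
      h (toLex (j, k)) = c j ∨ h (toLex (j, k)) ∈ gap S a (c j) := by
    rintro j (_ | k) hp
    · exact Or.inl rfl
    · rw [mem_model] at hp
      exact Or.inr (heg j hp.1 k hp.2)
  refine ⟨τ, Represents.unique (f := a) (S := S) ?_ a.represents_self⟩
  have hmono : StrictMonoOn h (model κ τ) := by
    intro p hp q hq hpq
    obtain ⟨i, k, rfl⟩ := exists_toLex p
    obtain ⟨j, l, rfl⟩ := exists_toLex q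
    have hp' := (mem_model _ _).1 hp
    have hq' := (mem_model _ _).1 hq
    rcases toLex_lt.1 hpq with hij | ⟨rfl, hkl⟩
    · exact head_lt (hcc j hq'.1) (hhead i k hp) (hhead j l hq)
        (hc (by simpa using hp'.1) (by simpa using hq'.1) hij)
    · obtain _ | l := l
      · omega
      · obtain _ | k := k
        · exact (mem_gap.1 (heg i hq'.1 l hq'.2)).2.1
        · exact he i hq'.1 (by simpa using hp'.2) (by simpa using hq'.2) (by omega)
  have hcomm : ∀ p ∈ model κ τ, a (h p) = h (modelMap κ τ p) := by
    intro p hp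
    obtain ⟨j, _ | k, rfl⟩ := exists_toLex p
    · exact hcf j ((mem_model _ _).1 hp).1
    · exact hef j ((mem_model _ _).1 hp).1 k ((mem_model _ _).1 hp).2
  have himage : (model κ τ).image h = S := by
    ext x
    rw [Finset.mem_image]
    constructor
    · rintro ⟨p, hp, rfl⟩
      obtain ⟨j, k, rfl⟩ := exists_toLex p
      rcases hhead j k hp with h' | h'
      · rw [h']
        exact core_subset _ _ (hcc j ((mem_model _ _).1 hp).1)
      · exact gap_subset _ _ _ h'
    · intro hx
      obtain ⟨d, hd, hxd⟩ := exists_head (f := a) hx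
      rw [← hcS] at hd
      obtain ⟨j, hj, rfl⟩ := Finset.mem_image.1 hd
      rw [Finset.mem_range] at hj
      rcases hxd with rfl | hxd
      · exact ⟨toLex (j, 0), by simpa using hj, rfl⟩
      · rw [← heS j hj] at hxd
        obtain ⟨k, hk, rfl⟩ := Finset.mem_image.1 hxd
        exact ⟨toLex (j, k + 1), (mem_model _ _).2 ⟨hj, Finset.mem_range.1 hk⟩, rfl⟩
  rw [← himage]
  exact (assemble_represents κ τ).image hmono hcomm

end Represents

end FinInvolution

/-! ### Statistics of an assembled involution -/

namespace InvolutionPattern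

variable {α : Type*} [LinearOrder α]

theorem occ_eq_card (S : Finset α) (f : α → α) :
    occ S f = ((S ×ˢ S ×ˢ S ×ˢ S).filter fun p => p.1 < p.2.1 ∧ p.2.1 < p.2.2.1 ∧
      p.2.2.1 < p.2.2.2 ∧ f p.2.2.1 < f p.2.2.2 ∧ f p.2.2.2 < f p.1 ∧ f p.1 < f p.2.1).card := by
  rw [Finset.card_filter]
  simp only [Finset.sum_product]
  rfl

/-- Each of the four kinds of triples needs a position or a value above the interval. -/
theorem occPoint_eq_zero {T : Finset α} {f : α → α} {lo : α → Prop} (h : ∀ p ∈ T, lo p)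
    (h' : ∀ p ∈ T, lo (f p)) : occPoint T f lo = 0 := by
  classical
  unfold occPoint
  simp only [Nat.add_eq_zero_iff, Finset.sum_eq_zero_iff, ite_eq_right_iff, one_ne_zero, imp_false,
    and_assoc]
  exact ⟨fun b hb _ _ _ _ hP => hP.1 (h b hb), fun _ _ c hc _ _ hP => hP.2.1 (h c hc),
    fun _ _ _ _ d hd hP => hP.2.2.1 (h d hd), fun a ha _ _ _ _ hP => hP.2.2.2.2.1 (h' a ha)⟩

theorem occPair_eq_zero {T : Finset α} {f : α → α} {lo : α → Prop} (h : ∀ p ∈ T, lo p)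
    (h' : ∀ p ∈ T, lo (f p)) : occPair T f lo = 0 := by
  classical
  unfold occPair
  simp only [Nat.add_eq_zero_iff, Finset.sum_eq_zero_iff, ite_eq_right_iff, one_ne_zero, imp_false]
  exact ⟨fun c hc _ _ hP => hP.1 (h c hc), fun a ha _ _ hP => hP.2.2.1 (h' a ha)⟩

end InvolutionPattern

theorem min_add_congr {N a b c d : ℕ} (h : min a N = min b N) (h' : min c N = min d N) :
    min (a + c) N = min (b + d) N := by
  omega

/-- A product reaches `N` once a factor does, unless the other factor is zero; and for `N > 0`
truncation still shows whether a factor is zero. -/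
theorem min_mul_congr {N a b c d : ℕ} (h : min a N = min b N) (h' : min c N = min d N) :
    min (a * c) N = min (b * d) N := by
  rcases lt_or_ge a N with ha | ha <;> rcases lt_or_ge c N with hc | hc
  · have h1 : a = b := by omega
    have h2 : c = d := by omega
    rw [h1, h2]
  · obtain rfl : a = b := by omega
    rcases Nat.eq_zero_or_pos a with rfl | ha0
    · simp
    · have h1 : c ≤ a * c := Nat.le_mul_of_pos_left c ha0
      have h2 : d ≤ a * d := Nat.le_mul_of_pos_left d ha0
      omega
  · obtain rfl : c = d := by omega
    rcases Nat.eq_zero_or_pos c with rfl | hc0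
    · simp
    · have h1 : a ≤ a * c := Nat.le_mul_of_pos_right a hc0
      have h2 : b ≤ b * c := Nat.le_mul_of_pos_right b hc0
      omega
  · rcases Nat.eq_zero_or_pos N with rfl | hN
    · simp
    · have h1 : a ≤ a * c := Nat.le_mul_of_pos_right a (by omega)
      have h2 : b ≤ b * d := Nat.le_mul_of_pos_right b (by omega)
      omega

namespace FinInvolution

/-- The number of occurrences of `3412`. -/
def numOcc (a : FinInvolution) : ℕ := occ (Finset.range a.size) a

/-- The number of occurrences of `12`. -/
def numInc (a : FinInvolution) : ℕ := inc (Finset.range a.size) a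

/-- The number of two-cycles. -/
def numArcs (a : FinInvolution) : ℕ := arcs (Finset.range a.size) a

/-- The involution of no letters. -/
def empty : FinInvolution := ⟨0, id, fun _ => rfl, fun _ _ => rfl⟩

@[simp] theorem size_empty : empty.size = 0 := rfl

theorem eq_empty {a : FinInvolution} (h : a.size = 0) : a = empty :=
  FinInvolution.ext h (funext fun k => a.fixes k (by omega))

@[simp] theorem numOcc_empty : empty.numOcc = 0 := rfl

@[simp] theorem numArcs_empty : empty.numArcs = 0 := rfl

variable (κ : FinInvolution) (τ : ℕ → FinInvolution)

theorem sum_model {M : Type*} [AddCommMonoid M] (F : ℕ ×ₗ ℕ → M) :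
    ∑ p ∈ model κ τ, F p = ∑ j ∈ Finset.range κ.size,
      (F (toLex (j, 0)) + ∑ k ∈ Finset.range (τ j).size, F (toLex (j, k + 1))) := by
  rw [model, Finset.sum_biUnion]
  · refine Finset.sum_congr rfl fun j _ => ?_
    rw [Finset.sum_image (fun k _ l _ h => by simpa using h), Finset.sum_range_succ', add_comm]
  · intro i _ j _ hij
    rw [Function.onFun, Finset.disjoint_left]
    intro p hp hp'
    simp only [Finset.mem_image] at hp hp'
    obtain ⟨k, _, rfl⟩ := hp
    obtain ⟨l, _, h⟩ := hp'
    simp only [toLex_inj, Prod.mk.injEq] at h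
    exact hij h.1.symm

theorem size_assemble :
    (assemble κ τ).size = κ.size + ∑ j ∈ Finset.range κ.size, (τ j).size := by
  rw [← (assemble_represents κ τ).card_eq, Finset.card_eq_sum_ones, sum_model]
  simp [Finset.sum_add_distrib]

theorem numArcs_assemble :
    (assemble κ τ).numArcs = κ.numArcs + ∑ j ∈ Finset.range κ.size, (τ j).numArcs := by
  rw [numArcs, ← (assemble_represents κ τ).arcs_eq, arcs, sum_model, Finset.sum_add_distrib]
  simp only [modelMap_zero, modelMap_succ, toLex_lt, lt_irrefl, true_and, and_false, or_false,
    false_or, Nat.add_lt_add_iff_right]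
  rfl

/-! ### The effect of a single inserted involution -/

section Update

variable {κ τ} {j : ℕ}

/-- The points of the model outside the `j`-th gap. -/
abbrev outside (κ : FinInvolution) (τ : ℕ → FinInvolution) (j : ℕ) : Finset (ℕ ×ₗ ℕ) :=
  model κ (Function.update τ j empty)

theorem model_eq_union (hj : j < κ.size) :
    model κ τ = outside κ τ j ∪ inserted (τ j).size j := by
  ext p
  obtain ⟨i, k, rfl⟩ := exists_toLex p
  rw [Finset.mem_union, mem_model, mem_model, mem_inserted]
  by_cases h : i = j
  · subst h
    simp only [Function.update_self, size_empty, true_and]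
    omega
  · simp [h]

theorem modelMap_outside {p : ℕ ×ₗ ℕ} (hp : p ∈ outside κ τ j) :
    modelMap κ τ p = modelMap κ (Function.update τ j empty) p := by
  obtain ⟨i, _ | k, rfl⟩ := exists_toLex p
  · rfl
  · rw [mem_model] at hp
    by_cases h : i = j
    · subst h
      simp at hp
    · simp [h]

theorem lt_inserted {p q : ℕ ×ₗ ℕ} {n : ℕ} (hq : q ∈ inserted n j) (h : p ≤ toLex (j, 0)) :
    p < q := by
  obtain ⟨i, k, rfl⟩ := exists_toLex p
  obtain ⟨i', l, rfl⟩ := exists_toLex q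
  rw [mem_inserted] at hq
  rw [toLex_le] at h
  rw [toLex_lt]
  omega

theorem inserted_lt {p q : ℕ ×ₗ ℕ} {n : ℕ} (hp : p ∈ outside κ τ j) (hq : q ∈ inserted n j)
    (h : ¬ p ≤ toLex (j, 0)) : q < p := by
  obtain ⟨i, k, rfl⟩ := exists_toLex p
  obtain ⟨i', l, rfl⟩ := exists_toLex q
  rw [mem_inserted] at hq
  rw [toLex_le] at h
  rw [toLex_lt]
  rw [mem_model] at hp
  by_cases hi : i = j
  · subst hi
    simp only [Function.update_self, size_empty] at hp
    omega
  · omega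

theorem modelMap_outside_mem {p : ℕ ×ₗ ℕ} (hp : p ∈ outside κ τ j) :
    modelMap κ τ p ∈ outside κ τ j := by
  rw [modelMap_outside hp]
  exact model_closed _ _ p hp

variable (κ τ)

/-- The copy of `τ j` is an invariant interval and the rest of the model is invariant, so
`occ_insert` applies. The coefficients do not involve `τ j`, as they are computed with the `j`-th
gap emptied. -/
theorem numOcc_assemble (hj : j < κ.size) :
    (assemble κ τ).numOcc = (assemble κ (Function.update τ j empty)).numOcc +
      (τ j).size * occPoint (outside κ τ j) (modelMap κ (Function.update τ j empty))
        (· ≤ toLex (j, 0)) +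
      (τ j).numInc * occPair (outside κ τ j) (modelMap κ (Function.update τ j empty))
        (· ≤ toLex (j, 0)) + (τ j).numOcc := by
  have hout : ∀ p ∈ outside κ τ j, _ := fun p => modelMap_outside
  rw [numOcc, ← (assemble_represents κ τ).occ_eq, model_eq_union hj,
    occ_insert (lo := (· ≤ toLex (j, 0))) (fun p hp => modelMap_outside_mem hp)
      (isBlock_inserted κ τ hj).closed (fun p _ q hq h => lt_inserted hq h)
      (fun p hp q hq h => inserted_lt hp hq h), occ_congr hout, occPoint_congr _ hout,
    occPair_congr _ hout, (represents_inserted κ τ j).card_eq, (represents_inserted κ τ j).inc_eq,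
    (represents_inserted κ τ j).occ_eq, (assemble_represents κ _).occ_eq]
  rfl

theorem numInc_assemble (hj : j < κ.size) :
    (assemble κ τ).numInc = (assemble κ (Function.update τ j empty)).numInc +
      (τ j).size * incPoint (outside κ τ j) (modelMap κ (Function.update τ j empty))
        (· ≤ toLex (j, 0)) + (τ j).numInc := by
  have hout : ∀ p ∈ outside κ τ j, _ := fun p => modelMap_outside
  rw [numInc, ← (assemble_represents κ τ).inc_eq, model_eq_union hj,
    inc_insert (lo := (· ≤ toLex (j, 0))) (fun p hp => modelMap_outside_mem hp)
      (isBlock_inserted κ τ hj).closed (fun p _ q hq h => lt_inserted hq h)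
      (fun p hp q hq h => inserted_lt hp hq h), inc_congr hout, incPoint_congr _ hout,
    (represents_inserted κ τ j).card_eq, (represents_inserted κ τ j).inc_eq,
    (assemble_represents κ _).inc_eq]
  rfl

/-- Nothing lies above the last gap, so no occurrence mixes its points with others. -/
theorem numOcc_assemble_last (hj : j + 1 = κ.size) :
    (assemble κ τ).numOcc =
      (assemble κ (Function.update τ j empty)).numOcc + (τ j).numOcc := by
  have h : ∀ p ∈ outside κ τ j, p ≤ toLex (j, 0) := fun p hp => by
    obtain ⟨i, k, rfl⟩ := exists_toLex p
    rw [mem_model] at hp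
    rw [toLex_le]
    by_cases hi : i = j
    · subst hi
      simp only [Function.update_self, size_empty] at hp
      omega
    · omega
  have h' : ∀ p ∈ outside κ τ j,
      modelMap κ (Function.update τ j empty) p ≤ toLex (j, 0) :=
    fun p hp => h _ (model_closed _ _ p hp)
  rw [numOcc_assemble κ τ (by omega : j < κ.size), occPoint_eq_zero h h', occPair_eq_zero h h',
    mul_zero, mul_zero, add_zero, add_zero]

end Update

/-- The truncations at `N` of the numbers of occurrences of `3412` and `12` and of the size. -/
def signature (N : ℕ) (a : FinInvolution) : Fin (N + 1) × Fin (N + 1) × Fin (N + 1) :=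
  (⟨min a.numOcc N, by omega⟩, ⟨min a.numInc N, by omega⟩, ⟨min a.size N, by omega⟩)

theorem signature_eq_iff {N : ℕ} {a b : FinInvolution} :
    signature N a = signature N b ↔ min a.numOcc N = min b.numOcc N ∧
      min a.numInc N = min b.numInc N ∧ min a.size N = min b.size N := by
  simp [signature]

variable {κ τ}

theorem assemble_truncated_congr_single {N j : ℕ} {τ τ' : ℕ → FinInvolution} (hj : j < κ.size)
    (h : Function.update τ j empty = Function.update τ' j empty)
    (hs : signature N (τ j) = signature N (τ' j)) :
    min (assemble κ τ).numOcc N = min (assemble κ τ').numOcc N ∧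
      min (assemble κ τ).numInc N = min (assemble κ τ').numInc N := by
  obtain ⟨h1, h2, h3⟩ := signature_eq_iff.1 hs
  rw [numOcc_assemble κ τ hj, numOcc_assemble κ τ' hj, numInc_assemble κ τ hj,
    numInc_assemble κ τ' hj, outside, outside, h]
  exact ⟨min_add_congr (min_add_congr (min_add_congr rfl (min_mul_congr h3 rfl))
    (min_mul_congr h2 rfl)) h1, min_add_congr (min_add_congr rfl (min_mul_congr h3 rfl)) h2⟩

/-- Exchange the entries one at a time; each exchange only alters the size and the two counts of one
entry, which enter through sums and products with fixed numbers. -/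
theorem assemble_truncated_congr {N : ℕ} {τ τ' : ℕ → FinInvolution}
    (hs : ∀ j < κ.size, signature N (τ j) = signature N (τ' j))
    (h : ∀ j, κ.size ≤ j → τ j = τ' j) :
    min (assemble κ τ).numOcc N = min (assemble κ τ').numOcc N ∧
      min (assemble κ τ).numInc N = min (assemble κ τ').numInc N := by
  have key : ∀ i ≤ κ.size, min (assemble κ τ).numOcc N =
      min (assemble κ fun j => if j < i then τ' j else τ j).numOcc N ∧
      min (assemble κ τ).numInc N =
      min (assemble κ fun j => if j < i then τ' j else τ j).numInc N := by
    intro i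
    induction i with
    | zero => simp
    | succ i ih =>
      intro hi
      obtain ⟨h1, h2⟩ := ih (by omega)
      rw [h1, h2]
      refine assemble_truncated_congr_single (j := i) (by omega) ?_ ?_
      · ext1 j
        by_cases hji : j = i
        · subst hji
          simp
        · simp only [Function.update_of_ne hji]
          exact if_congr (by omega) rfl rfl
      · simpa using hs i (by omega)
  obtain ⟨h1, h2⟩ := key κ.size le_rfl
  have : (fun j => if j < κ.size then τ' j else τ j) = τ' := by
    ext1 j
    split_ifs with hj
    · rfl
    · exact h j (by omega)
  rw [this] at h1 h2
  exact ⟨h1, h2⟩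

theorem HasCore.numOcc_le {a : FinInvolution} (h : a.HasCore κ) : κ.numOcc ≤ a.numOcc := by
  rw [numOcc, ← h.occ_eq]
  exact occ_mono (core_subset _ _) _

theorem HasCore.numInc_le {a : FinInvolution} (h : a.HasCore κ) : κ.numInc ≤ a.numInc := by
  rw [numInc, ← h.inc_eq]
  exact inc_mono (core_subset _ _) _

/-- Emptying the `j`-th gap leaves the core intact, so the occurrences in the core are counted apart
from those in `τ j`. -/
theorem numOcc_add_le (hκ : κ.IsPrimitive) {j : ℕ} (hj : j < κ.size) :
    κ.numOcc + (τ j).numOcc ≤ (assemble κ τ).numOcc := by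
  have := (hasCore_assemble (τ := Function.update τ j empty) hκ).numOcc_le
  rw [numOcc_assemble κ τ hj]
  omega

theorem numInc_add_le (hκ : κ.IsPrimitive) {j : ℕ} (hj : j < κ.size) :
    κ.numInc + (τ j).numInc ≤ (assemble κ τ).numInc := by
  have := (hasCore_assemble (τ := Function.update τ j empty) hκ).numInc_le
  rw [numInc_assemble κ τ hj]
  omega

/-! ### Primitive involutions -/

/-- Suppose that the cycle `p ≤ q` of `v` crosses no other. The points strictly between form a block
above `p`, hence there are none and `q ≤ p + 1`. Then the cycle itself is a block unless `p = 0`. In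
that case the points after `q` form a block, which contains 2 since `q ≤ 1` and there are at least
three points. -/
theorem IsPrimitive.exists_crossing (hκ : κ.IsPrimitive) (h3 : 3 ≤ κ.size) {v : ℕ}
    (hv : v < κ.size) : ∃ x y, x < y ∧ y < κ x ∧ κ x < κ y ∧ κ y < κ.size ∧
      (v = x ∨ v = y ∨ v = κ x ∨ v = κ y) := by
  by_contra hno
  obtain ⟨p, q, hpq, hp, hq, hqn, hv⟩ : ∃ p q, p ≤ q ∧ κ p = q ∧ κ q = p ∧ q < κ.size ∧
      (v = p ∨ v = q) := by
    have hκv := κ.apply_lt hv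
    rcases le_total v (κ v) with h | h
    · exact ⟨v, κ v, h, rfl, κ.apply_apply v, hκv, Or.inl rfl⟩
    · exact ⟨κ v, v, h, κ.apply_apply v, rfl, hv, Or.inr rfl⟩
  have hno' : ∀ x y, x < y → y < κ x → κ x < κ y → κ y < κ.size →
      ¬ (v = x ∨ v = y ∨ v = κ x ∨ v = κ y) :=
    fun x y h1 h2 h3 h4 h5 => hno ⟨x, y, h1, h2, h3, h4, h5⟩
  have hinj : ∀ x y, κ x = κ y → x = y := fun x y h => κ.involutive.injective h
  have hinner : IsBlock (Finset.range κ.size) κ (Finset.Ioo p q) := by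
    refine ⟨fun x hx => ?_, fun x hx => ?_, fun x hx y hy z hz hxz hzy => ?_, p, ?_, fun x hx => ?_⟩
    · rw [Finset.mem_Ioo] at hx
      exact Finset.mem_range.2 (by omega)
    · rw [Finset.mem_Ioo] at hx ⊢
      have h1 : κ x ≠ p := fun h => by
        have := hinj x q (h.trans hq.symm)
        omega
      have h2 : κ x ≠ q := fun h => by
        have := hinj x p (h.trans hp.symm)
        omega
      have hx' := κ.apply_lt (show x < κ.size by omega)
      have hxx := κ.apply_apply x
      constructor
      · by_contra h
        exact hno' (κ x) p (by omega) (by omega) (by omega) (by omega) (by omega)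
      · by_contra h
        exact hno' p x (by omega) (by omega) (by omega) (by omega) (by omega)
    · rw [Finset.mem_Ioo] at *
      omega
    · exact Finset.mem_range.2 (by omega)
    · exact (Finset.mem_Ioo.1 hx).1
  have hqp : q ≤ p + 1 := by
    by_contra h
    have := hκ.2 _ hinner
    exact Finset.notMem_empty (p + 1) (this ▸ Finset.mem_Ioo.2 (by omega))
  have hp0 : p = 0 := by
    by_contra hp0
    have hB : IsBlock (Finset.range κ.size) κ (Finset.Icc p q) := by
      refine ⟨fun x hx => ?_, fun x hx => ?_, fun x hx y hy z hz hxz hzy => ?_, 0, ?_,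
        fun x hx => ?_⟩
      · rw [Finset.mem_Icc] at hx
        exact Finset.mem_range.2 (by omega)
      · rw [Finset.mem_Icc] at hx ⊢
        obtain rfl | rfl : x = p ∨ x = q := by omega
        · omega
        · omega
      · rw [Finset.mem_Icc] at *
        omega
      · exact Finset.mem_range.2 (by omega)
      · rw [Finset.mem_Icc] at hx
        omega
    have := hκ.2 _ hB
    exact Finset.notMem_empty p (this ▸ Finset.mem_Icc.2 (by omega))
  subst hp0
  have hB : IsBlock (Finset.range κ.size) κ (Finset.Ioo q κ.size) := by
    refine ⟨fun x hx => ?_, fun x hx => ?_, fun x hx y hy z hz hxz hzy => ?_, 0, ?_,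
      fun x hx => ?_⟩
    · rw [Finset.mem_Ioo] at hx
      exact Finset.mem_range.2 (by omega)
    · rw [Finset.mem_Ioo] at hx ⊢
      have hx' := κ.apply_lt hx.2
      have h1 : κ x ≠ 0 := fun h => by
        have := hinj x q (h.trans hq.symm)
        omega
      have h2 : κ x ≠ q := fun h => by
        have := hinj x 0 (h.trans hp.symm)
        omega
      omega
    · rw [Finset.mem_Ioo] at *
      omega
    · exact Finset.mem_range.2 (by omega)
    · rw [Finset.mem_Ioo] at hx
      omega
  have := hκ.2 _ hB
  exact Finset.notMem_empty 2 (this ▸ Finset.mem_Ioo.2 (by omega))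

/-- Crossing two-cycles `x < y < κ x < κ y` give the occurrence `(x, y, κ x, κ y)`, so the
occurrences, four points each, cover all points. -/
theorem IsPrimitive.size_le (hκ : κ.IsPrimitive) (h3 : 3 ≤ κ.size) :
    κ.size ≤ 4 * κ.numOcc := by
  rw [numOcc, occ_eq_card]
  set Q := (Finset.range κ.size ×ˢ Finset.range κ.size ×ˢ Finset.range κ.size ×ˢ
    Finset.range κ.size).filter fun p => p.1 < p.2.1 ∧ p.2.1 < p.2.2.1 ∧
      p.2.2.1 < p.2.2.2 ∧ κ p.2.2.1 < κ p.2.2.2 ∧ κ p.2.2.2 < κ p.1 ∧ κ p.1 < κ p.2.1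
  have hsub : Finset.range κ.size ⊆
      Q.biUnion fun p => {p.1, p.2.1, p.2.2.1, p.2.2.2} := by
    intro v hv
    obtain ⟨x, y, h1, h2, h3, h4, h5⟩ := hκ.exists_crossing h3 (Finset.mem_range.1 hv)
    rw [Finset.mem_biUnion]
    refine ⟨(x, y, κ x, κ y), ?_, by simpa using h5⟩
    simp only [Q, Finset.mem_filter, Finset.mem_product, Finset.mem_range, apply_apply]
    omega
  calc κ.size = (Finset.range κ.size).card := (Finset.card_range _).symm
    _ ≤ _ := Finset.card_le_card hsub
    _ ≤ Q.card * 4 := Finset.card_biUnion_le_card_mul _ _ _ fun p _ => Finset.card_le_four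
    _ = _ := mul_comm _ _

theorem IsPrimitive.numInc_pos (hκ : κ.IsPrimitive) (h3 : 3 ≤ κ.size) : 1 ≤ κ.numInc := by
  obtain ⟨x, y, h1, h2, h3, h4, -⟩ := hκ.exists_crossing h3 (by omega : 0 < κ.size)
  exact one_le_inc (Finset.mem_range.2 (by omega)) (Finset.mem_range.2 (by omega)) h1 h3

/-- The involution of one letter. -/
def point : FinInvolution := ⟨1, id, fun _ => rfl, fun _ _ => rfl⟩

/-- The transposition of two letters. -/
def arc : FinInvolution where
  size := 2
  toFun := Equiv.swap 0 1
  involutive := Equiv.swap_apply_self 0 1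
  fixes k hk := Equiv.swap_apply_of_ne_of_ne (by omega) (by omega)

@[simp] theorem size_point : point.size = 1 := rfl

@[simp] theorem size_arc : arc.size = 2 := rfl

@[simp] theorem arc_zero : arc 0 = 1 := Equiv.swap_apply_left 0 1

@[simp] theorem arc_one : arc 1 = 0 := Equiv.swap_apply_right 0 1

theorem eq_point (h : κ.size = 1) : κ = point := by
  refine FinInvolution.ext h (funext fun k => ?_)
  rcases Nat.eq_zero_or_pos k with rfl | hk
  · have := κ.apply_lt (show 0 < κ.size by omega)
    change κ 0 = 0
    omega
  · exact κ.fixes k (by omega)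

theorem IsPrimitive.eq_arc (hκ : κ.IsPrimitive) (h : κ.size = 2) : κ = arc := by
  have h0 : κ 0 = 1 := by
    by_contra h0
    have h0' := κ.apply_lt (show 0 < κ.size by omega)
    have h1' := κ.apply_lt (show 1 < κ.size by omega)
    have h00 : κ 0 = 0 := by omega
    have h1 : κ 1 = 1 := by
      by_contra h1
      have h10 : κ 1 = 0 := by omega
      have := κ.involutive.injective (h10.trans h00.symm)
      omega
    have hB : IsBlock (Finset.range κ.size) κ {1} := by
      refine ⟨by simp [h], by simpa using h1, ?_, 0, by simp [h], by simp⟩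
      simp only [Finset.mem_singleton]
      omega
    exact Finset.singleton_ne_empty 1 (hκ.2 _ hB)
  have h1 : κ 1 = 0 := by rw [← h0, apply_apply]
  refine FinInvolution.ext h (funext fun k => ?_)
  rcases k with _ | _ | k
  · exact h0.trans arc_zero.symm
  · exact h1.trans arc_one.symm
  · exact (κ.fixes _ (by omega)).trans (arc.fixes _ (by simp)).symm

theorem isPrimitive_point : point.IsPrimitive := by
  refine ⟨one_ne_zero, fun I hI => ?_⟩
  obtain ⟨s, hs, h⟩ := hI.above
  refine Finset.eq_empty_of_forall_notMem fun x hx => ?_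
  have h1 := Finset.mem_range.1 (hI.subset hx)
  have h2 := h x hx
  simp at h1
  omega

theorem isPrimitive_arc : arc.IsPrimitive := by
  refine ⟨two_ne_zero, fun I hI => ?_⟩
  obtain ⟨s, hs, h⟩ := hI.above
  refine Finset.eq_empty_of_forall_notMem fun x hx => ?_
  have h1 := Finset.mem_range.1 (hI.subset hx)
  have h2 := h x hx
  simp only [size_arc] at h1
  obtain rfl : x = 1 := by omega
  have h3 := h _ (hI.closed 1 hx)
  simp at h3

@[simp] theorem numOcc_point : point.numOcc = 0 := by decide

@[simp] theorem numArcs_point : point.numArcs = 0 := by decide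

@[simp] theorem numOcc_arc : arc.numOcc = 0 := by decide

@[simp] theorem numInc_arc : arc.numInc = 0 := by decide

@[simp] theorem numArcs_arc : arc.numArcs = 1 := by decide

end FinInvolution

/-! ### Small primitive involutions -/

open Sized

namespace InvolutionPattern

variable {α : Type*} [LinearOrder α] {T : Finset α} {f : α → α} {lo : α → Prop}

/-- The hypothesis leaves at most one point on either side of the interval. It is meant for the two
ends of a two-cycle enclosing the interval. -/
theorem occPoint_eq_zero_of_separated (h : ∀ p ∈ T, ∀ q ∈ T, p < q → lo p ∧ ¬ lo q) :
    occPoint T f lo = 0 := by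
  classical
  unfold occPoint
  simp only [Nat.add_eq_zero_iff, Finset.sum_eq_zero_iff, ite_eq_right_iff, one_ne_zero, imp_false,
    and_assoc]
  exact ⟨fun b hb c hc _ _ hP => hP.1 (h b hb c hc hP.2.1).1,
    fun _ _ c hc d hd hP => hP.2.1 (h c hc d hd hP.2.2.1).1,
    fun a ha b hb _ _ hP => (h a ha b hb hP.1).2 hP.2.1,
    fun _ _ b hb c hc hP => (h b hb c hc hP.2.1).2 hP.2.2.1⟩

theorem occPair_eq_zero_of_separated (h : ∀ p ∈ T, ∀ q ∈ T, p < q → lo p ∧ ¬ lo q) :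
    occPair T f lo = 0 := by
  classical
  unfold occPair
  simp only [Nat.add_eq_zero_iff, Finset.sum_eq_zero_iff, ite_eq_right_iff, one_ne_zero, imp_false]
  exact ⟨fun c hc d hd hP => hP.1 (h c hc d hd hP.2.1).1,
    fun a ha b hb hP => (h a ha b hb hP.1).2 hP.2.1⟩

theorem incPoint_eq_zero_of_separated {α : Type*} {T : Finset α} {f : α → α} {lo : α → Prop}
    (h : ∀ p ∈ T, lo p ↔ ¬ lo (f p)) : incPoint T f lo = 0 := by
  classical
  unfold incPoint
  simp only [Nat.add_eq_zero_iff, Finset.sum_eq_zero_iff, ite_eq_right_iff, one_ne_zero, imp_false]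
  exact ⟨fun a ha hP => (h a ha).1 hP.1 hP.2, fun b hb hP => hP.1 ((h b hb).2 hP.2)⟩

theorem one_le_incPoint {α : Type*} {T : Finset α} {f : α → α} {lo : α → Prop}
    {p : α} (hp : p ∈ T) (h : lo p) (h' : lo (f p)) :
    1 ≤ incPoint T f lo := by
  classical
  unfold incPoint
  exact (one_le_sum hp (by simp [h, h'])).trans (Nat.le_add_right _ _)

end InvolutionPattern

namespace FinInvolution

variable {κ : FinInvolution} {τ : ℕ → FinInvolution}

theorem outside_eq_vertices {j : ℕ}
    (h : ∀ i < κ.size, Function.update τ j empty i = empty) :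
    outside κ τ j = vertices κ.size := by
  ext p
  obtain ⟨i, k, rfl⟩ := exists_toLex p
  rw [mem_model, mem_vertices]
  constructor
  · rintro ⟨h1, h2⟩
    rw [h i h1, size_empty] at h2
    exact ⟨h1, by omega⟩
  · rintro ⟨h1, rfl⟩
    exact ⟨h1, Nat.zero_le _⟩

theorem assemble_congr {τ' : ℕ → FinInvolution} (h : ∀ j < κ.size, τ j = τ' j) :
    assemble κ τ = assemble κ τ' := by
  have hm : model κ τ = model κ τ' := by
    ext p
    obtain ⟨i, k, rfl⟩ := exists_toLex p
    rw [mem_model, mem_model]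
    exact and_congr_right fun hi => by rw [h i hi]
  have h1 := (assemble_represents κ τ).image (g := modelMap κ τ') strictMonoOn_id fun p hp => by
    obtain ⟨i, _ | k, rfl⟩ := exists_toLex p
    · rfl
    · simp [h i ((mem_model _ _).1 hp).1]
  rw [Finset.image_id, hm] at h1
  exact h1.unique (assemble_represents κ τ')

theorem assemble_of_empty (h : ∀ j < κ.size, τ j = empty) : assemble κ τ = κ := by
  rw [assemble_congr (τ' := fun _ => empty) h]
  have h1 := assemble_represents κ fun _ => empty
  have : model κ (fun _ => empty) = vertices κ.size := by
    ext p
    obtain ⟨i, k, rfl⟩ := exists_toLex p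
    simp
  rw [this] at h1
  exact h1.unique (represents_vertices κ _)

theorem numOcc_assemble_point : (assemble point τ).numOcc = (τ 0).numOcc := by
  rw [numOcc_assemble_last point τ (j := 0) rfl, assemble_of_empty, numOcc_point, zero_add]
  intro j hj
  rw [size_point] at hj
  obtain rfl : j = 0 := by omega
  simp

/-- The core point forms a 12 with every inserted point. -/
theorem size_le_numInc_point : (τ 0).size ≤ (assemble point τ).numInc := by
  rw [numInc_assemble point τ (j := 0) (by simp)]
  have : 1 ≤ incPoint (outside point τ 0) (modelMap point (Function.update τ 0 empty))
      (· ≤ toLex (0, 0)) :=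
    one_le_incPoint (p := toLex (0, 0)) (by simp) le_rfl le_rfl
  have := Nat.le_mul_of_pos_right (τ 0).size this
  omega

/-- Every point of the second gap forms a 12 with the first end of the two-cycle; these pairs are
distinct from those inside the first gap. -/
theorem size_add_le_numInc_arc :
    (τ 1).size + (τ 0).numInc ≤ (assemble arc τ).numInc := by
  have h := numInc_add_le (τ := Function.update τ 1 empty) isPrimitive_arc (j := 0) (by simp)
  rw [Function.update_of_ne (by simp), numInc_arc, zero_add] at h
  rw [numInc_assemble arc τ (j := 1) (by simp)]
  have : 1 ≤ incPoint (outside arc τ 1) (modelMap arc (Function.update τ 1 empty))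
      (· ≤ toLex (1, 0)) := by
    refine one_le_incPoint (p := toLex (0, 0)) (by simp) ?_ ?_
    · rw [toLex_le]
      omega
    · rw [modelMap_zero, arc_zero]
  have := Nat.le_mul_of_pos_right (τ 1).size this
  omega

theorem arc_update (h1 : τ 1 = empty) : ∀ i < arc.size, Function.update τ 0 empty i = empty := by
  intro i hi
  rw [size_arc] at hi
  rcases i with _ | _ | i
  · simp
  · simpa using h1
  · omega

/-- The first end of the enclosing two-cycle lies before and has a value above everything enclosed,
the second end the opposite, so neither end takes part in a 3412, nor in a 12. Such a core therefore
reproduces the class of the enclosed involution. -/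
theorem numOcc_assemble_arc_of_empty (h1 : τ 1 = empty) :
    (assemble arc τ).numOcc = (τ 0).numOcc := by
  have hsep : ∀ p ∈ outside arc τ 0, ∀ q ∈ outside arc τ 0, p < q →
      p ≤ toLex (0, 0) ∧ ¬ q ≤ toLex (0, 0) := by
    rw [outside_eq_vertices (arc_update h1)]
    intro p hp q hq hpq
    obtain ⟨i, k, rfl⟩ := exists_toLex p
    obtain ⟨j, l, rfl⟩ := exists_toLex q
    rw [mem_vertices] at hp hq
    rw [size_arc] at hp hq
    rw [toLex_lt] at hpq
    rw [toLex_le, toLex_le]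
    omega
  rw [numOcc_assemble arc τ (j := 0) (by simp), occPoint_eq_zero_of_separated hsep,
    occPair_eq_zero_of_separated hsep, assemble_of_empty (arc_update h1), numOcc_arc]
  ring

theorem numInc_assemble_arc_of_empty (h1 : τ 1 = empty) :
    (assemble arc τ).numInc = (τ 0).numInc := by
  have hsep : ∀ p ∈ outside arc τ 0, p ≤ toLex (0, 0) ↔
      ¬ modelMap arc (Function.update τ 0 empty) p ≤ toLex (0, 0) := by
    rw [outside_eq_vertices (arc_update h1)]
    intro p hp
    obtain ⟨i, k, rfl⟩ := exists_toLex p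
    obtain ⟨hi, rfl⟩ := mem_vertices.1 hp
    rw [size_arc] at hi
    rcases i with _ | _ | i
    · simp [toLex_le]
    · simp [toLex_le]
    · omega
  rw [numInc_assemble arc τ (j := 0) (by simp), incPoint_eq_zero_of_separated hsep,
    assemble_of_empty (arc_update h1), numInc_arc]
  ring

theorem numOcc_assemble_arc :
    (assemble arc τ).numOcc = (τ 0).numOcc + (τ 1).numOcc := by
  rw [numOcc_assemble_last arc τ (j := 1) rfl,
    numOcc_assemble_arc_of_empty (by simp), Function.update_of_ne (by simp)]

/-! ### Generating functions of involutions -/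

instance : Sized FinInvolution where
  size := FinInvolution.size
  finite_size n := by
    let F : ({a : FinInvolution | a.size = n} : Set FinInvolution) → Fin n → Fin n :=
      fun a i => ⟨a.1 i, (a.1.apply_lt (i.2.trans_eq a.2.symm)).trans_eq a.2⟩
    have hF : Function.Injective F := by
      rintro ⟨a, ha⟩ ⟨b, hb⟩ h
      refine Subtype.ext (FinInvolution.ext (ha.trans hb.symm) (funext fun k => ?_))
      rcases lt_or_ge k n with hk | hk
      · exact congrArg Fin.val (congrFun h ⟨k, hk⟩)
      · exact (a.fixes k (ha ▸ hk)).trans (b.fixes k (hb ▸ hk)).symm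
    exact Set.finite_coe_iff.1 (Finite.of_injective F hF)

/-- The weight `t ^ (number of two-cycles)`. -/
def weight (t : ℚ) (a : FinInvolution) : ℚ := t ^ a.numArcs

/-- A tuple of involutions, continued by the empty involution. -/
def extend {m : ℕ} (τ : Fin m → FinInvolution) (j : ℕ) : FinInvolution :=
  if h : j < m then τ ⟨j, h⟩ else empty

theorem extend_of_lt {m : ℕ} (τ : Fin m → FinInvolution) {j : ℕ} (h : j < m) :
    extend τ j = τ ⟨j, h⟩ := dif_pos h

theorem extend_val {m : ℕ} (τ : Fin m → FinInvolution) (j : Fin m) : extend τ j = τ j :=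
  extend_of_lt τ j.2

theorem extend_of_le {m : ℕ} (τ : Fin m → FinInvolution) {j : ℕ} (h : m ≤ j) :
    extend τ j = empty := dif_neg (not_lt.2 h)

/-- The involution obtained from `κ` by inserting the involutions of a tuple after its points. -/
noncomputable def insertAll (κ : FinInvolution) (τ : Fin κ.size → FinInvolution) : FinInvolution :=
  assemble κ (extend τ)

theorem insertAll_injective (hκ : κ.IsPrimitive) : Function.Injective (insertAll κ) := by
  intro τ τ' h
  funext j
  have := assemble_injective hκ h j.2
  rwa [extend_val τ j, extend_val τ' j] at this

theorem exists_insertAll_eq {a : FinInvolution} (h : a.HasCore κ) : ∃ τ, insertAll κ τ = a := by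
  obtain ⟨τ, rfl⟩ := exists_assemble_eq h
  refine ⟨fun j => τ j, assemble_congr fun j hj => ?_⟩
  rw [extend_of_lt _ hj]

theorem sum_extend {m : ℕ} (τ : Fin m → FinInvolution) (F : FinInvolution → ℕ) :
    ∑ j ∈ Finset.range m, F (extend τ j) = ∑ j, F (τ j) := by
  rw [Finset.sum_range]
  exact Finset.sum_congr rfl fun j _ => by rw [extend_val τ j]

theorem size_insertAll (τ : Fin κ.size → FinInvolution) :
    Sized.size (insertAll κ τ) = Sized.size τ + κ.size := by
  refine (size_assemble κ _).trans ?_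
  rw [sum_extend, add_comm]
  rfl

theorem weight_insertAll (t : ℚ) (τ : Fin κ.size → FinInvolution) :
    weight t (insertAll κ τ) = t ^ κ.numArcs * ∏ j, weight t (τ j) := by
  simp only [weight]
  rw [insertAll, numArcs_assemble, sum_extend, pow_add, Finset.prod_pow_eq_pow_sum]

theorem insertAll_truncated_congr {N : ℕ} {τ τ' : Fin κ.size → FinInvolution}
    (h : ∀ j, signature N (τ j) = signature N (τ' j)) :
    min (insertAll κ τ).numOcc N = min (insertAll κ τ').numOcc N ∧
      min (insertAll κ τ).numInc N = min (insertAll κ τ').numInc N := by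
  refine assemble_truncated_congr (fun j hj => ?_) fun j hj => ?_
  · rw [extend_of_lt τ hj, extend_of_lt τ' hj, h]
  · rw [extend_of_le τ hj, extend_of_le τ' hj]

theorem finite_primitive (r : ℕ) : {κ : FinInvolution | κ.IsPrimitive ∧ κ.numOcc ≤ r}.Finite := by
  -- `4 * r` bounds the size of primitives with at least three points; the summand 2 admits the
  -- smaller ones.
  refine ((Set.finite_Iic (4 * r + 2)).biUnion
    fun n _ => finite_size (X := FinInvolution) n).subset ?_
  rintro κ ⟨hκ, hr⟩
  simp only [Set.mem_iUnion, Set.mem_ofPred_eq, Set.mem_Iic, exists_prop]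
  refine ⟨_, ?_, rfl⟩
  change κ.size ≤ _
  by_cases h : 3 ≤ κ.size
  · have := hκ.size_le h
    omega
  · omega

/-- The primitive involutions with at most `r` occurrences of `3412`. -/
noncomputable def primitives (r : ℕ) : Finset FinInvolution := (finite_primitive r).toFinset

noncomputable instance : DecidableEq FinInvolution := Classical.decEq _

theorem mem_primitives {r : ℕ} : κ ∈ primitives r ↔ κ.IsPrimitive ∧ κ.numOcc ≤ r := by
  simp [primitives]

/-- The generating function of the tuples that are inserted into `κ` to elements of `E`. -/
noncomputable def tupleGF (t : ℚ) (E : Set FinInvolution) (κ : FinInvolution) : PowerSeries ℚ :=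
  gf (fun τ : Fin κ.size → FinInvolution => ∏ j, weight t (τ j)) {τ | insertAll κ τ ∈ E}

/-- Sort the nonempty elements of `E` by core. A core has no more occurrences than the whole, so
only the finitely many elements of `primitives r` appear. -/
theorem gf_eq_sum_primitives (t : ℚ) {E : Set FinInvolution} {r : ℕ} (hE : ∀ a ∈ E, a.numOcc ≤ r) :
    gf (weight t) E = gf (weight t) (E ∩ {empty}) + ∑ κ ∈ primitives r,
      PowerSeries.X ^ κ.size * (PowerSeries.C (t ^ κ.numArcs) * tupleGF t E κ) := by
  classical
  rw [gf_eq_add_diff (weight t) E {empty}]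
  congr 1
  have hne : ∀ a ∈ E \ {empty}, a.size ≠ 0 := fun a ha h => ha.2 (eq_empty h)
  have hex : ∀ a : FinInvolution, a ∈ E \ {empty} → ∃ κ, κ.IsPrimitive ∧ a.HasCore κ :=
    fun a ha => exists_hasCore (hne a ha)
  choose! c hc hac using hex
  rw [gf_fiberwise _ (primitives r) c fun a ha =>
    mem_primitives.2 ⟨hc a ha, (hac a ha).numOcc_le.trans (hE a ha.1)⟩]
  refine Finset.sum_congr rfl fun κ hκ => ?_
  rw [mem_primitives] at hκ
  rw [tupleGF, ← gf_image (insertAll κ) (insertAll_injective hκ.1) κ.size (t ^ κ.numArcs)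
    size_insertAll (weight_insertAll t)]
  congr 1
  ext a
  constructor
  · rintro ⟨ha, rfl⟩
    obtain ⟨τ, hτ⟩ := exists_insertAll_eq (hac a ha)
    exact ⟨τ, by simpa [hτ] using ha.1, hτ⟩
  · rintro ⟨τ, hτ, rfl⟩
    have hmem : insertAll κ τ ∈ E \ {empty} := by
      refine ⟨hτ, fun h => hκ.1.1 ?_⟩
      have := size_assemble κ (extend τ)
      rw [← insertAll, h, size_empty] at this
      omega
    exact ⟨hmem, (hac _ hmem).unique (hasCore_assemble hκ.1)⟩

end FinInvolution

/-! ### Rationality of the generating functions -/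

namespace FinInvolution

section Classes

variable {k : ℕ} {u : Fin k → PowerSeries ℚ} (t : ℚ)

theorem gf_diff_rational {E E' : Set FinInvolution}
    (h : IsRationalFunctionOf u (gf (weight t) E))
    (h' : IsRationalFunctionOf u (gf (weight t) (E ∩ E'))) :
    IsRationalFunctionOf u (gf (weight t) (E \ E')) := by
  have := h.sub h'
  rwa [gf_eq_add_diff _ E E', add_sub_cancel_left] at this

theorem gf_rational_of_size {E : Set FinInvolution} (hX : IsRationalFunctionOf u PowerSeries.X)
    (N : ℕ) (h : ∀ a ∈ E, a.size < N) : IsRationalFunctionOf u (gf (weight t) E) :=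
  gf_rational_of_size_lt hX _ N h

/-- The involutions with `l` occurrences of `3412`. -/
def occClass (l : ℕ) : Set FinInvolution := {a | a.numOcc = l}

/-- The involutions with `l` occurrences of `3412` and `k` occurrences of `12`. -/
def occIncClass (l k : ℕ) : Set FinInvolution := {a | a.numOcc = l ∧ a.numInc = k}

theorem signatureClass_rational_of_size (hX : IsRationalFunctionOf u PowerSeries.X) {N : ℕ}
    {b : FinInvolution} (hb : b.size < N) :
    IsRationalFunctionOf u (gf (weight t) {a | signature N a = signature N b}) := by
  refine gf_rational_of_size t hX N fun a ha => ?_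
  have := signature_eq_iff.1 ha
  omega

/-- A signature entry below `N` is exact, and an entry `N` means at least `N`. So the class either
has bounded size or arises from a class with both counts prescribed by removing finitely many
involutions. -/
theorem signatureClass_rational_of_inc (hX : IsRationalFunctionOf u PowerSeries.X) {N : ℕ}
    {b : FinInvolution} (ho : b.numOcc < N) (hi : b.numInc < N)
    (h : IsRationalFunctionOf u (gf (weight t) (occIncClass b.numOcc b.numInc))) :
    IsRationalFunctionOf u (gf (weight t) {a | signature N a = signature N b}) := by
  by_cases hb : b.size < N
  · exact signatureClass_rational_of_size t hX hb
  · have : {a | signature N a = signature N b} =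
        occIncClass b.numOcc b.numInc \ {a | a.size < N} := by
      ext a
      simp only [Set.mem_ofPred_eq, signature_eq_iff, Set.mem_sdiff, occIncClass]
      omega
    rw [this]
    exact gf_diff_rational t h (gf_rational_of_size t hX N fun a ha => ha.2)

/-- When the number of 12s is also truncated, the class is all of `occClass` without finitely many
classes of fixed smaller 12-count and without the small sizes. -/
theorem signatureClass_rational (hX : IsRationalFunctionOf u PowerSeries.X) {N : ℕ}
    {b : FinInvolution} (ho : b.numOcc < N)
    (h : IsRationalFunctionOf u (gf (weight t) (occClass b.numOcc)))
    (hU : ∀ k, IsRationalFunctionOf u (gf (weight t) (occIncClass b.numOcc k))) :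
    IsRationalFunctionOf u (gf (weight t) {a | signature N a = signature N b}) := by
  by_cases hi : b.numInc < N
  · exact signatureClass_rational_of_inc t hX ho hi (hU _)
  by_cases hb : b.size < N
  · exact signatureClass_rational_of_size t hX hb
  · have : {a | signature N a = signature N b} =
        (occClass b.numOcc \ {a | a.numInc < N}) \ {a | a.size < N} := by
      ext a
      simp only [Set.mem_ofPred_eq, signature_eq_iff, Set.mem_sdiff, occClass]
      omega
    rw [this]
    refine gf_diff_rational t (gf_diff_rational t h ?_) (gf_rational_of_size t hX N fun a ha => ha.2)
    rw [gf_fiberwise _ (Finset.range N) numInc fun a ha => Finset.mem_range.2 ha.2]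
    refine IsRationalFunctionOf.sum _ fun k hk => ?_
    have : {a | a ∈ occClass b.numOcc ∩ {a | a.numInc < N} ∧ a.numInc = k} =
        occIncClass b.numOcc k := by
      ext a
      rw [Finset.mem_range] at hk
      simp only [Set.mem_ofPred_eq, Set.mem_inter_iff, occClass, occIncClass]
      omega
    rw [this]
    exact hU k

theorem tupleGF_summand_rational (hX : IsRationalFunctionOf u PowerSeries.X)
    {E : Set FinInvolution} {κ : FinInvolution} (h : IsRationalFunctionOf u (tupleGF t E κ)) :
    IsRationalFunctionOf u
      (PowerSeries.X ^ κ.size * (PowerSeries.C (t ^ κ.numArcs) * tupleGF t E κ)) :=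
  (hX.pow _).mul ((IsRationalFunctionOf.const _).mul h)

theorem gf_inter_empty_rational (hX : IsRationalFunctionOf u PowerSeries.X)
    (E : Set FinInvolution) : IsRationalFunctionOf u (gf (weight t) (E ∩ {empty})) := by
  refine gf_rational_of_size t hX 1 fun a ha => ?_
  rw [Set.mem_singleton_iff.1 ha.2]
  simp

theorem IsPrimitive.cases {κ : FinInvolution} (hκ : κ.IsPrimitive) :
    κ = point ∨ κ = arc ∨ 3 ≤ κ.size := by
  by_cases h : 3 ≤ κ.size
  · exact Or.inr (Or.inr h)
  · have := hκ.1
    obtain h1 | h2 : κ.size = 1 ∨ κ.size = 2 := by omega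
    · exact Or.inl (eq_point h1)
    · exact Or.inr (Or.inl (hκ.eq_arc h2))

theorem gf_empty : gf (weight t) {empty} = 1 := by
  classical
  ext n
  rw [coeff_gf, PowerSeries.coeff_one]
  split_ifs with hn
  · subst hn
    rw [Finset.sum_eq_single empty]
    · simp [weight]
    · intro a _ ha
      simp [ha]
    · intro h
      exact absurd (mem_fiber.2 rfl) h
  · refine Finset.sum_eq_zero fun a ha => if_neg fun h => hn ?_
    rw [← mem_fiber.1 ha, Set.mem_singleton_iff.1 h]
    rfl

theorem gf_pair (A B : Set FinInvolution) :
    gf (fun τ : Fin 2 → FinInvolution => ∏ j, weight t (τ j))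
      {τ | extend τ 0 ∈ A ∧ extend τ 1 ∈ B} = gf (weight t) A * gf (weight t) B := by
  have h := gf_pi (weight t) (m := 2) ![A, B]
  rw [Fin.prod_univ_two] at h
  refine Eq.trans ?_ h
  congr 1
  ext τ
  rw [Set.mem_univ_pi, Fin.forall_fin_two]
  rfl

theorem gf_single (A : Set FinInvolution) :
    gf (fun τ : Fin 1 → FinInvolution => ∏ j, weight t (τ j))
      {τ | extend τ 0 ∈ A} = gf (weight t) A := by
  have h := gf_pi (weight t) (m := 1) ![A]
  rw [Fin.prod_univ_one] at h
  refine Eq.trans ?_ h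
  congr 1
  ext τ
  rw [Set.mem_univ_pi, Fin.forall_fin_one]
  rfl

theorem gf_arc_pair (A B : Set FinInvolution) :
    gf (fun τ : Fin arc.size → FinInvolution => ∏ j, weight t (τ j))
      {τ | extend τ 0 ∈ A ∧ extend τ 1 ∈ B} = gf (weight t) A * gf (weight t) B :=
  gf_pair t A B

theorem gf_point_single (A : Set FinInvolution) :
    gf (fun τ : Fin point.size → FinInvolution => ∏ j, weight t (τ j))
      {τ | extend τ 0 ∈ A} = gf (weight t) A :=
  gf_single t A

theorem one_sub_X_mul_ne_zero (G : PowerSeries ℚ) : (1 - PowerSeries.X * G) ≠ 0 := fun h => by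
  have := congrArg PowerSeries.constantCoeff h
  simp at this

/-- Strong induction on `k`, for all `l` at once. With a fixed point as core, the inserted size is
at most `k`. A core of at least three points contains a 12, so its entries have fewer than `k`. With
a two-cycle as core, a nonempty second entry has size at most `k` and forces fewer than `k` 12s in
the first; an empty one gives back the class itself. Hence `1 - t x²` times the series is rational.
-/
theorem occInc_rational (hX : IsRationalFunctionOf u PowerSeries.X) (l k : ℕ) :
    IsRationalFunctionOf u (gf (weight t) (occIncClass l k)) := by
  induction k using Nat.strong_induction_on generalizing l with
  | _ k ih =>
  -- Truncating above both `l` and `k` keeps the two counts, and every size at most `k`, exact.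
  set N := l + k + 1 with hN
  set E := occIncClass l k with hE
  have hcongr : ∀ {κ : FinInvolution} {τ τ' : Fin κ.size → FinInvolution},
      (∀ j, signature N (τ j) = signature N (τ' j)) → insertAll κ τ ∈ E → insertAll κ τ' ∈ E := by
    rintro κ τ τ' h ⟨h1, h2⟩
    obtain ⟨h3, h4⟩ := insertAll_truncated_congr h
    exact ⟨by omega, by omega⟩
  have hocc : ∀ {κ : FinInvolution} {τ : Fin κ.size → FinInvolution}, κ.IsPrimitive →
      insertAll κ τ ∈ E → ∀ j, κ.numOcc + (τ j).numOcc ≤ l ∧ κ.numInc + (τ j).numInc ≤ k := by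
    rintro κ τ hκ ⟨h1, h2⟩ j
    have h3 := numOcc_add_le (τ := extend τ) hκ j.2
    have h4 := numInc_add_le (τ := extend τ) hκ j.2
    rw [extend_val τ j] at h3 h4
    rw [insertAll] at h1 h2
    exact ⟨by omega, by omega⟩
  have hpoint : IsRationalFunctionOf u (tupleGF t E point) := by
    refine gf_pi_rational_of_class _ (signature N) _ (fun τ τ' h => hcongr h) fun τ hτ j => ?_
    refine signatureClass_rational_of_size t hX ?_
    have h := size_le_numInc_point (τ := extend τ)
    rw [extend_of_lt τ (by simp : 0 < point.size)] at h
    have h2 : (insertAll point τ).numInc = k := hτ.2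
    rw [insertAll] at h2
    have : j = ⟨0, by simp⟩ := Subsingleton.elim (α := Fin 1) _ _
    rw [this]
    omega
  have hlarge : ∀ κ : FinInvolution, κ.IsPrimitive → 3 ≤ κ.size →
      IsRationalFunctionOf u (tupleGF t E κ) := by
    intro κ hκ h3
    refine gf_pi_rational_of_class _ (signature N) _ (fun τ τ' h => hcongr h) fun τ hτ j => ?_
    have h1 := hocc hκ hτ j
    have h2 := hκ.numInc_pos h3
    exact signatureClass_rational_of_inc t hX (by omega) (by omega) (ih _ (by omega) _)
  -- `R` comes from the pairs whose second entry is nonempty.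
  have harc : ∃ R, IsRationalFunctionOf u R ∧ tupleGF t E arc = gf (weight t) E + R := by
    refine ⟨gf (fun τ : Fin arc.size → FinInvolution => ∏ j, weight t (τ j))
      ({τ | insertAll arc τ ∈ E} \ {τ | (extend τ 1).size = 0}), ?_, ?_⟩
    rotate_left
    · rw [tupleGF, gf_eq_add_diff _ _ {τ : Fin arc.size → FinInvolution | (extend τ 1).size = 0}]
      congr 1
      rw [← mul_one (gf (weight t) E), ← gf_empty t, ← gf_arc_pair]
      congr 1
      ext τ
      simp only [Set.mem_inter_iff, Set.mem_ofPred_eq, Set.mem_singleton_iff]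
      constructor
      · rintro ⟨⟨h1, h2⟩, h0⟩
        have h0 := eq_empty h0
        rw [insertAll, numOcc_assemble_arc_of_empty h0] at h1
        rw [insertAll, numInc_assemble_arc_of_empty h0] at h2
        exact ⟨⟨h1, h2⟩, h0⟩
      · rintro ⟨⟨h1, h2⟩, h0⟩
        refine ⟨⟨?_, ?_⟩, by rw [h0]; rfl⟩
        · rw [insertAll, numOcc_assemble_arc_of_empty h0, h1]
        · rw [insertAll, numInc_assemble_arc_of_empty h0, h2]
    · refine gf_pi_rational_of_class _ (signature N) _ (fun τ τ' h => ?_) fun τ hτ j => ?_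
      · rintro ⟨h1, h2⟩
        refine ⟨hcongr h h1, fun h3 => h2 ?_⟩
        have h4 := (signature_eq_iff.1 (h ⟨1, by simp⟩)).2.2
        simp only [Set.mem_ofPred_eq] at h3 ⊢
        rw [extend_of_lt _ (by simp : 1 < arc.size)] at h3 ⊢
        omega
      · obtain ⟨h1, h2⟩ := hτ
        have h3 := hocc isPrimitive_arc h1 j
        have h4 := size_add_le_numInc_arc (τ := extend τ)
        have h5 : (insertAll arc τ).numInc = k := h1.2
        simp only [Set.mem_ofPred_eq] at h2
        rw [insertAll] at h5
        rw [extend_of_lt _ (by simp : 1 < arc.size)] at h2 h4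
        rw [extend_of_lt _ (by simp : 0 < arc.size)] at h4
        obtain ⟨j, hj⟩ := j
        obtain rfl | rfl : j = 0 ∨ j = 1 := by
          rw [size_arc] at hj
          omega
        · exact signatureClass_rational_of_inc t hX (by omega) (by omega) (ih _ (by omega) _)
        · exact signatureClass_rational_of_size t hX (by omega)
  obtain ⟨R, hR, harc⟩ := harc
  have hmem : arc ∈ primitives l := mem_primitives.2 ⟨isPrimitive_arc, by simp⟩
  have hsum := gf_eq_sum_primitives t (E := E) (r := l) fun a ha => ha.1.le
  rw [← Finset.add_sum_erase _ _ hmem, harc, size_arc, numArcs_arc] at hsum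
  set G := gf (weight t) E with hG
  set Z := gf (weight t) (E ∩ {empty}) with hZ
  set W := ∑ κ ∈ (primitives l).erase arc,
    PowerSeries.X ^ κ.size * (PowerSeries.C (t ^ κ.numArcs) * tupleGF t E κ) with hW
  have hZr : IsRationalFunctionOf u Z := gf_inter_empty_rational t hX E
  have hWr : IsRationalFunctionOf u W := by
    refine IsRationalFunctionOf.sum _ fun κ hκ => tupleGF_summand_rational t hX ?_
    obtain ⟨hne, hκ⟩ := Finset.mem_erase.1 hκ
    have hκ := (mem_primitives.1 hκ).1
    rcases hκ.cases with rfl | rfl | h3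
    · exact hpoint
    · exact absurd rfl hne
    · exact hlarge κ hκ h3
  refine IsRationalFunctionOf.of_mul_left
    (G := 1 - PowerSeries.X * (PowerSeries.X * PowerSeries.C (t ^ 1)))
    (one_sub_X_mul_ne_zero _)
    (IsRationalFunctionOf.one.sub (hX.mul (hX.mul (IsRationalFunctionOf.const _)))) ?_
  have : (1 - PowerSeries.X * (PowerSeries.X * PowerSeries.C (t ^ 1))) * G =
      Z + W + PowerSeries.X ^ 2 * (PowerSeries.C (t ^ 1) * R) := by
    linear_combination hsum
  rw [this]
  exact (hZr.add hWr).add ((hX.pow 2).mul ((IsRationalFunctionOf.const _).mul hR))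

/-- The part of the generating function of the involutions with `r` occurrences of `3412` that
comes from larger cores. -/
noncomputable def largeCoreGF (t : ℚ) (r : ℕ) : PowerSeries ℚ :=
  gf (weight t) (occClass r ∩ {empty}) + ∑ κ ∈ ((primitives r).erase arc).erase point,
    PowerSeries.X ^ κ.size * (PowerSeries.C (t ^ κ.numArcs) * tupleGF t (occClass r) κ)

/-- A fixed point as core preserves the number of occurrences, and a two-cycle adds those of its two
entries. This yields a recursion of Motzkin type with `largeCoreGF` as inhomogeneous term. -/
theorem gf_occClass_eq (r : ℕ) :
    gf (weight t) (occClass r) = largeCoreGF t r + PowerSeries.X * gf (weight t) (occClass r) +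
      PowerSeries.X ^ 2 * (PowerSeries.C t * ∑ p ∈ Finset.HasAntidiagonal.antidiagonal r,
        gf (weight t) (occClass p.1) * gf (weight t) (occClass p.2)) := by
  have hpoint : tupleGF t (occClass r) point = gf (weight t) (occClass r) := by
    rw [tupleGF, ← gf_point_single]
    congr 1
    ext τ
    simp only [Set.mem_ofPred_eq, occClass, insertAll, numOcc_assemble_point]
  have harc : tupleGF t (occClass r) arc = ∑ p ∈ Finset.HasAntidiagonal.antidiagonal r,
      gf (weight t) (occClass p.1) * gf (weight t) (occClass p.2) := by
    rw [tupleGF, gf_fiberwise _ (Finset.HasAntidiagonal.antidiagonal r)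
      fun τ => ((extend τ 0).numOcc, (extend τ 1).numOcc)]
    · refine Finset.sum_congr rfl fun p hp => ?_
      rw [← gf_arc_pair]
      congr 1
      ext τ
      rw [Finset.HasAntidiagonal.mem_antidiagonal] at hp
      simp only [Set.mem_ofPred_eq, occClass, insertAll, numOcc_assemble_arc, Prod.ext_iff]
      omega
    · intro τ hτ
      rw [Finset.HasAntidiagonal.mem_antidiagonal]
      have h : (insertAll arc τ).numOcc = r := hτ
      rwa [insertAll, numOcc_assemble_arc] at h
  have hne : point ≠ arc := fun h => by simpa using congrArg FinInvolution.size h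
  have hmem : arc ∈ primitives r := mem_primitives.2 ⟨isPrimitive_arc, by simp⟩
  have hmem' : point ∈ (primitives r).erase arc :=
    Finset.mem_erase.2 ⟨hne, mem_primitives.2 ⟨isPrimitive_point, by simp⟩⟩
  have hsum := gf_eq_sum_primitives t (E := occClass r) (r := r) fun a ha => le_of_eq ha
  rw [← Finset.add_sum_erase _ _ hmem, ← Finset.add_sum_erase _ _ hmem', harc, hpoint, size_arc,
    numArcs_arc, size_point, numArcs_point, pow_one, pow_one, pow_zero, map_one, one_mul] at hsum
  rw [largeCoreGF]
  linear_combination hsum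

/-- A core with at least three points contains an occurrence, so each entry has fewer than `r`.
Truncation at `r + 1` keeps the value `r` exact. -/
theorem largeCoreGF_rational (hX : IsRationalFunctionOf u PowerSeries.X) {r : ℕ}
    (h : ∀ l < r, IsRationalFunctionOf u (gf (weight t) (occClass l))) :
    IsRationalFunctionOf u (largeCoreGF t r) := by
  refine (gf_inter_empty_rational t hX _).add
    (IsRationalFunctionOf.sum _ fun κ hκ => tupleGF_summand_rational t hX ?_)
  obtain ⟨hne, hκ⟩ := Finset.mem_erase.1 hκ
  obtain ⟨hne', hκ⟩ := Finset.mem_erase.1 hκ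
  have hκ := (mem_primitives.1 hκ).1
  rcases hκ.cases with rfl | rfl | h3
  · exact absurd rfl hne
  · exact absurd rfl hne'
  refine gf_pi_rational_of_class _ (signature (r + 1)) _ (fun τ τ' hs hτ => ?_) fun τ hτ j => ?_
  · have h1 : (insertAll κ τ).numOcc = r := hτ
    have h2 := (insertAll_truncated_congr hs).1
    change (insertAll κ τ').numOcc = r
    omega
  · have h1 : (insertAll κ τ).numOcc = r := hτ
    have h2 := numOcc_add_le (τ := extend τ) hκ j.2
    rw [extend_val τ j] at h2
    rw [insertAll] at h1
    have h4 := hκ.size_le h3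
    exact signatureClass_rational t hX (by omega) (h _ (by omega)) fun k =>
      occInc_rational t hX _ k

/-- Without occurrences a core has at most two points, so only the empty involution contributes. -/
theorem largeCoreGF_zero : largeCoreGF t 0 = 1 := by
  have h : ((primitives 0).erase arc).erase point = ∅ := by
    refine Finset.eq_empty_of_forall_notMem fun κ hκ => ?_
    obtain ⟨hne, hκ⟩ := Finset.mem_erase.1 hκ
    obtain ⟨hne', hκ⟩ := Finset.mem_erase.1 hκ
    obtain ⟨hκ, h0⟩ := mem_primitives.1 hκ
    rcases hκ.cases with h | h | h3
    · exact hne h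
    · exact hne' h
    · have := hκ.size_le h3
      omega
  have h' : occClass 0 ∩ {empty} = {empty} := by
    rw [Set.inter_eq_right, Set.singleton_subset_iff]
    exact numOcc_empty
  rw [largeCoreGF, h, h', gf_empty]
  simp

theorem gf_occClass_zero_eq :
    gf (weight t) (occClass 0) = 1 + PowerSeries.X * gf (weight t) (occClass 0) +
      PowerSeries.X ^ 2 * (PowerSeries.C t * gf (weight t) (occClass 0) ^ 2) := by
  have h := gf_occClass_eq t 0
  rwa [largeCoreGF_zero, Finset.HasAntidiagonal.antidiagonal_zero, Finset.sum_singleton,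
    ← sq] at h

/-- For `r > 0` the unknown series enters the convolution only through the two distinct end terms,
so the recursion is linear in it; its coefficient `1 - x - 2 t x² F` has constant term 1. -/
theorem occ_rational (hX : IsRationalFunctionOf u PowerSeries.X)
    (h0 : IsRationalFunctionOf u (gf (weight t) (occClass 0))) (r : ℕ) :
    IsRationalFunctionOf u (gf (weight t) (occClass r)) := by
  induction r using Nat.strong_induction_on with
  | _ r ih =>
  rcases Nat.eq_zero_or_pos r with rfl | hr
  · exact h0
  have hsum := gf_occClass_eq t r
  have hne : ((r, 0) : ℕ × ℕ) ≠ (0, r) := fun h => by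
    have := congrArg Prod.fst h
    simp only at this
    omega
  have hm : ((0, r) : ℕ × ℕ) ∈ Finset.HasAntidiagonal.antidiagonal r := by simp
  have hm' : ((r, 0) : ℕ × ℕ) ∈ (Finset.HasAntidiagonal.antidiagonal r).erase (0, r) := by
    simp [hr.ne']
  rw [← Finset.add_sum_erase _ _ hm, ← Finset.add_sum_erase _ _ hm'] at hsum
  set G := gf (weight t) (occClass r) with hG
  set F := gf (weight t) (occClass 0) with hF
  set W := ∑ p ∈ ((Finset.HasAntidiagonal.antidiagonal r).erase (0, r)).erase (r, 0),
    gf (weight t) (occClass p.1) * gf (weight t) (occClass p.2) with hW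
  have hWr : IsRationalFunctionOf u W := by
    refine IsRationalFunctionOf.sum _ fun p hp => ?_
    simp only [Finset.mem_erase, Finset.HasAntidiagonal.mem_antidiagonal, ne_eq, Prod.ext_iff] at hp
    exact (ih _ (by omega)).mul (ih _ (by omega))
  have hL := largeCoreGF_rational t hX ih
  have hC : IsRationalFunctionOf u (PowerSeries.C t) := IsRationalFunctionOf.const _
  have h2 : IsRationalFunctionOf u (PowerSeries.C 2) := IsRationalFunctionOf.const _
  refine IsRationalFunctionOf.of_mul_left
    (G := 1 - PowerSeries.X * (1 + PowerSeries.C 2 * PowerSeries.X * PowerSeries.C t * F))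
    (one_sub_X_mul_ne_zero _)
    (IsRationalFunctionOf.one.sub (hX.mul (IsRationalFunctionOf.one.add
      (((h2.mul hX).mul hC).mul h0)))) ?_
  have : (1 - PowerSeries.X * (1 + PowerSeries.C 2 * PowerSeries.X * PowerSeries.C t * F)) * G =
      largeCoreGF t r + PowerSeries.X ^ 2 * (PowerSeries.C t * W) := by
    have h2 : (PowerSeries.C 2 : PowerSeries ℚ) = 2 := map_ofNat PowerSeries.C 2
    rw [h2]
    linear_combination hsum
  rw [this]
  exact hL.add ((hX.pow 2).mul (hC.mul hWr))

/-- If `s` is the square root of `(1 - x)² - 4 t x²` with constant term `1` then the generating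
functions of the involutions by occurrences of `3412` are rational in `x` and `s`. -/
theorem occ_rational_of_sqrt (hX : IsRationalFunctionOf u PowerSeries.X) (ht : t ≠ 0)
    {s : PowerSeries ℚ} (hs : IsRationalFunctionOf u s) (hs0 : PowerSeries.constantCoeff s = 1)
    (hs2 : s ^ 2 = (1 - PowerSeries.X) ^ 2 - 4 * PowerSeries.C t * PowerSeries.X ^ 2) (r : ℕ) :
    IsRationalFunctionOf u (gf (weight t) (occClass r)) := by
  refine occ_rational t hX ?_ r
  have h := gf_occClass_zero_eq t
  set F := gf (weight t) (occClass 0)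
  -- Completing the square in the quadratic equation for `F`.
  have hprod : (s - (1 - PowerSeries.X - 2 * PowerSeries.C t * PowerSeries.X ^ 2 * F)) *
      (s + (1 - PowerSeries.X - 2 * PowerSeries.C t * PowerSeries.X ^ 2 * F)) = 0 := by
    linear_combination hs2 + 4 * PowerSeries.C t * PowerSeries.X ^ 2 * h
  -- The sign is fixed by the constant term: that of the second factor is 2.
  have hs' : s = 1 - PowerSeries.X - 2 * PowerSeries.C t * PowerSeries.X ^ 2 * F := by
    rcases mul_eq_zero.1 hprod with h | h
    · exact sub_eq_zero.1 h
    · have := congrArg PowerSeries.constantCoeff h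
      simp [hs0] at this
  refine IsRationalFunctionOf.of_mul_left (G := PowerSeries.C (2 * t) * PowerSeries.X ^ 2) ?_
    ((IsRationalFunctionOf.const _).mul (hX.pow 2)) ?_
  · refine mul_ne_zero ?_ (pow_ne_zero _ PowerSeries.X_ne_zero)
    rw [Ne, map_eq_zero_iff _ PowerSeries.C_injective]
    exact mul_ne_zero two_ne_zero ht
  · have : PowerSeries.C (2 * t) * PowerSeries.X ^ 2 * F = 1 - PowerSeries.X - s := by
      rw [hs', map_mul]
      have h2 : (PowerSeries.C 2 : PowerSeries ℚ) = 2 := map_ofNat PowerSeries.C 2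
      rw [h2]
      ring
    rw [this]
    exact (IsRationalFunctionOf.one.sub hX).sub hs

end Classes

end FinInvolution

/-! ### Involutive permutations -/

theorem patternCount_3412 {n : ℕ} (π : Equiv.Perm (Fin n)) :
    patternCount ![3, 4, 1, 2] π = occ Finset.univ π := by
  rw [occ_eq_card, patternCount]
  refine Finset.card_nbij' (fun i => (i 0, i 1, i 2, i 3)) (fun p => ![p.1, p.2.1, p.2.2.1, p.2.2.2])
    ?_ ?_ ?_ ?_
  · intro i hi
    simp only [Finset.coe_filter, Finset.mem_univ, true_and, Set.mem_ofPred_eq, Finset.mem_product]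
      at hi ⊢
    obtain ⟨h1, h2⟩ := hi
    exact ⟨h1 0 1 (by decide), h1 1 2 (by decide), h1 2 3 (by decide), (h2 2 3).2 (by decide),
      (h2 3 0).2 (by decide), (h2 0 1).2 (by decide)⟩
  · rintro ⟨a, b, c, d⟩ hp
    simp only [Finset.coe_filter, Finset.mem_univ, true_and, Set.mem_ofPred_eq, Finset.mem_product]
      at hp ⊢
    constructor
    · intro i j hij
      fin_cases i <;> fin_cases j <;> simp at hij ⊢ <;> omega
    · intro i j
      fin_cases i <;> fin_cases j <;> simp <;> omega
  · intro i _
    funext j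
    fin_cases j <;> rfl
  · intro p _
    rfl

theorem patternCount_21 {n : ℕ} (π : Equiv.Perm (Fin n)) :
    patternCount ![2, 1] π =
      (Finset.univ.filter fun p : Fin n × Fin n => p.1 < p.2 ∧ π p.2 < π p.1).card := by
  rw [patternCount]
  refine Finset.card_nbij' (fun i => (i 0, i 1)) (fun p => ![p.1, p.2]) ?_ ?_ ?_ ?_
  · intro i hi
    simp only [Finset.coe_filter, Finset.mem_univ, true_and, Set.mem_ofPred_eq] at hi ⊢
    obtain ⟨h1, h2⟩ := hi
    exact ⟨h1 0 1 (by decide), (h2 1 0).2 (by decide)⟩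
  · rintro ⟨a, b⟩ hp
    simp only [Finset.coe_filter, Finset.mem_univ, true_and, Set.mem_ofPred_eq] at hp ⊢
    constructor
    · intro i j hij
      fin_cases i <;> fin_cases j <;> simp at hij ⊢
      omega
    · intro i j
      fin_cases i <;> fin_cases j <;> simp <;> omega
  · intro i _
    funext j
    fin_cases j <;> rfl
  · intro p _
    rfl

/-- An involution has as many inversions as two-cycles, modulo `2`. -/
theorem even_patternCount_21_iff {n : ℕ} {π : Equiv.Perm (Fin n)} (hπ : ∀ x, π (π x) = x) :
    Even (patternCount ![2, 1] π) ↔ Even (arcs Finset.univ π) := by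
  rw [patternCount_21]
  set S := Finset.univ.filter fun p : Fin n × Fin n => p.1 < p.2 ∧ π p.2 < π p.1
  have hS : ∀ p, p ∈ S ↔ p.1 < p.2 ∧ π p.2 < π p.1 := fun p => by simp [S]
  -- The map (a, b) ↦ (π b, π a) pairs off the inversions with `a ≠ π b`, so they cancel modulo 2.
  have h1 : ((S.filter fun p => p.1 ≠ π p.2).card : ZMod 2) = 0 := by
    rw [Finset.card_eq_sum_ones, Nat.cast_sum]
    refine Finset.sum_involution (fun p _ => (π p.2, π p.1)) (fun _ _ => by decide) ?_ ?_ ?_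
    · intro p hp _ h
      exact (Finset.mem_filter.1 hp).2 (congrArg Prod.fst h).symm
    · intro p hp
      rw [Finset.mem_filter, hS] at hp ⊢
      simp only [hπ]
      exact ⟨⟨hp.1.2, hp.1.1⟩, fun h => hp.2 h.symm⟩
    · intro p _
      simp only [hπ]
  -- The inversions fixed by that map are the pairs `(a, π a)` with `a < π a`, one per two-cycle.
  have h2 : (S.filter fun p => ¬ p.1 ≠ π p.2).card = arcs Finset.univ π := by
    rw [arcs, ← Finset.card_filter]
    refine Finset.card_nbij' (fun p => p.1) (fun a => (a, π a)) ?_ ?_ ?_ ?_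
    · intro p hp
      simp only [Finset.coe_filter, hS, Finset.mem_univ, true_and, Set.mem_ofPred_eq, not_not]
        at hp ⊢
      have : π p.1 = p.2 := by rw [hp.2, hπ]
      rw [this]
      exact hp.1.1
    · intro a ha
      simp only [Finset.coe_filter, hS, Finset.mem_univ, true_and, Set.mem_ofPred_eq, not_not, hπ]
        at ha ⊢
      exact ⟨⟨ha, ha⟩, trivial⟩
    · intro p hp
      simp only [Finset.coe_filter, hS, Set.mem_ofPred_eq, not_not] at hp
      exact Prod.ext rfl (by simp only [hp.2, hπ])
    · intro a _
      rfl
  rw [← Finset.card_filter_add_card_filter_not (s := S) fun p => p.1 ≠ π p.2, h2, Nat.even_add]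
  have : Even (S.filter fun p => p.1 ≠ π p.2).card := (ZMod.natCast_eq_zero_iff_even).1 h1
  simp [this]

namespace FinInvolution

/-- An involutive permutation as an involution. -/
def ofPerm {n : ℕ} (π : Equiv.Perm (Fin n)) (hπ : ∀ x, π (π x) = x) : FinInvolution where
  size := n
  toFun k := if h : k < n then π ⟨k, h⟩ else k
  involutive k := by
    by_cases h : k < n
    · simp [h, hπ]
    · simp [h]
  fixes k hk := dif_neg (not_lt.2 hk)

variable {n : ℕ} {π : Equiv.Perm (Fin n)} (hπ : ∀ x, π (π x) = x)

theorem ofPerm_val (x : Fin n) : ofPerm π hπ x = π x := by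
  change (if h : (x : ℕ) < n then (π ⟨x, h⟩ : ℕ) else x) = π x
  rw [dif_pos x.2]

theorem ofPerm_injective {σ : Equiv.Perm (Fin n)} {hσ : ∀ x, σ (σ x) = x}
    (h : ofPerm π hπ = ofPerm σ hσ) : π = σ := by
  ext x
  rw [← ofPerm_val hπ, h, ofPerm_val hσ]

theorem exists_ofPerm_eq (a : FinInvolution) (ha : a.size = n) :
    ∃ (π : Equiv.Perm (Fin n)) (hπ : ∀ x, π (π x) = x), ofPerm π hπ = a := by
  subst ha
  let F : Fin a.size → Fin a.size := fun x => ⟨a x, a.apply_lt x.2⟩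
  have hF : Function.Involutive F := fun x => Fin.ext (a.apply_apply x)
  refine ⟨hF.toPerm, hF, FinInvolution.ext rfl (funext fun k => ?_)⟩
  rcases lt_or_ge k a.size with hk | hk
  · exact dif_pos hk
  · exact (dif_neg (not_lt.2 hk)).trans (a.fixes k hk).symm

theorem image_val_univ : (Finset.univ : Finset (Fin n)).image Fin.val = Finset.range n := by
  ext k
  simp only [Finset.mem_image, Finset.mem_univ, true_and, Finset.mem_range]
  exact ⟨fun ⟨x, hx⟩ => hx ▸ x.2, fun h => ⟨⟨k, h⟩, rfl⟩⟩

theorem numOcc_ofPerm : (ofPerm π hπ).numOcc = patternCount ![3, 4, 1, 2] π := by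
  rw [patternCount_3412, ← occ_image (e := Fin.val) (g := ofPerm π hπ)
    (Fin.val_strictMono.strictMonoOn _) (fun _ _ => Finset.mem_univ _) fun x _ => ofPerm_val hπ x, image_val_univ]
  rfl

theorem even_numArcs_ofPerm :
    Even (ofPerm π hπ).numArcs ↔ Even (patternCount ![2, 1] π) := by
  rw [even_patternCount_21_iff hπ, ← arcs_image (e := Fin.val) (g := ofPerm π hπ)
    (Fin.val_strictMono.strictMonoOn _) (fun _ _ => Finset.mem_univ _) fun x _ => ofPerm_val hπ x,
    image_val_univ]
  rfl

theorem mem_involutions3412 {r : ℕ} : π ∈ involutions3412 r n ↔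
    (∀ x, π (π x) = x) ∧ patternCount ![3, 4, 1, 2] π = r := by
  simp only [involutions3412, Finset.mem_filter, Finset.mem_univ, true_and]
  refine and_congr_left fun _ => ?_
  rw [eq_inv_iff_mul_eq_one, Equiv.ext_iff]
  rfl

/-- The number of involutive permutations whose number of inversions satisfies `P`, a property
that depends only on the parity. -/
theorem card_filter_involutions3412 (r : ℕ) {P : ℕ → Prop} [DecidablePred P]
    (hP : ∀ i j, (Even i ↔ Even j) → (P i ↔ P j)) :
    ((involutions3412 r n).filter fun π => P (patternCount ![2, 1] π)).card =
      ((fiber FinInvolution n).filter fun a => a.numOcc = r ∧ P a.numArcs).card := by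
  refine Finset.card_bij (fun π hπ => ofPerm π (mem_involutions3412.1
    (Finset.mem_filter.1 hπ).1).1) ?_ ?_ ?_
  · intro π hπ
    rw [Finset.mem_filter, mem_involutions3412] at hπ
    rw [Finset.mem_filter, mem_fiber, numOcc_ofPerm, hP _ _ (even_numArcs_ofPerm hπ.1.1)]
    exact ⟨rfl, hπ.1.2, hπ.2⟩
  · intro π _ σ _ h
    exact ofPerm_injective _ h
  · intro a ha
    rw [Finset.mem_filter, mem_fiber] at ha
    obtain ⟨π, hπ, rfl⟩ := exists_ofPerm_eq a ha.1
    refine ⟨π, ?_, rfl⟩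
    rw [numOcc_ofPerm, hP _ _ (even_numArcs_ofPerm hπ)] at ha
    rw [Finset.mem_filter, mem_involutions3412]
    exact ⟨⟨hπ, ha.2.1⟩, ha.2.2⟩

/-- `(1 + (-1) ^ m) / 2` is the indicator of even `m`, here the number of two-cycles. -/
theorem evenGF_eq (r : ℕ) : evenGF r = PowerSeries.C (1 / 2) *
    (gf (weight 1) (occClass r) + gf (weight (-1)) (occClass r)) := by
  classical
  ext n
  rw [evenGF, PowerSeries.coeff_mk, card_filter_involutions3412 r fun _ _ h => h,
    PowerSeries.coeff_C_mul, map_add, coeff_gf, coeff_gf, ← Finset.sum_add_distrib,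
    Finset.mul_sum, Finset.card_filter, Nat.cast_sum]
  refine Finset.sum_congr rfl fun a _ => ?_
  by_cases h : a.numOcc = r
  · have h' : a ∈ occClass r := h
    rcases Nat.even_or_odd a.numArcs with he | ho
    · simp [h, h', weight, he]
      norm_num
    · simp [h, h', weight, ho]
  · have h' : a ∉ occClass r := h
    simp [h, h']

theorem oddGF_eq (r : ℕ) : oddGF r = PowerSeries.C (1 / 2) *
    (gf (weight 1) (occClass r) - gf (weight (-1)) (occClass r)) := by
  classical
  ext n
  rw [oddGF, PowerSeries.coeff_mk, card_filter_involutions3412 r fun i j h => by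
      rw [← Nat.not_even_iff_odd, ← Nat.not_even_iff_odd, h],
    PowerSeries.coeff_C_mul, map_sub, coeff_gf, coeff_gf, ← Finset.sum_sub_distrib,
    Finset.mul_sum, Finset.card_filter, Nat.cast_sum]
  refine Finset.sum_congr rfl fun a _ => ?_
  by_cases h : a.numOcc = r
  · have h' : a ∈ occClass r := h
    rcases Nat.even_or_odd a.numArcs with he | ho
    · simp [h, h', weight, he]
    · simp [h, h', weight, ho]
      norm_num
  · have h' : a ∉ occClass r := h
    simp [h, h']

end FinInvolution

theorem corollary4p4 (r : ℕ) :
    IsRationalFunctionOf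
        ![PowerSeries.X,
          seriesSqrt (1 - 2 * PowerSeries.X - 3 * PowerSeries.X ^ 2),
          seriesSqrt (1 - 2 * PowerSeries.X + 5 * PowerSeries.X ^ 2)] (evenGF r) ∧
      IsRationalFunctionOf
        ![PowerSeries.X,
          seriesSqrt (1 - 2 * PowerSeries.X - 3 * PowerSeries.X ^ 2),
          seriesSqrt (1 - 2 * PowerSeries.X + 5 * PowerSeries.X ^ 2)] (oddGF r) := by
  set u : Fin 3 → PowerSeries ℚ := ![PowerSeries.X,
    seriesSqrt (1 - 2 * PowerSeries.X - 3 * PowerSeries.X ^ 2),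
    seriesSqrt (1 - 2 * PowerSeries.X + 5 * PowerSeries.X ^ 2)]
  have hX : IsRationalFunctionOf u PowerSeries.X := IsRationalFunctionOf.gen (u := u) 0
  have hc : PowerSeries.constantCoeff
      (1 - 2 * PowerSeries.X - 3 * PowerSeries.X ^ 2 : PowerSeries ℚ) = 1 := by simp
  have hc' : PowerSeries.constantCoeff
      (1 - 2 * PowerSeries.X + 5 * PowerSeries.X ^ 2 : PowerSeries ℚ) = 1 := by simp
  -- At `t = 1` the radicand is `(1 - x)² - 4x² = 1 - 2x - 3x²`.
  have h1 : IsRationalFunctionOf u (gf (FinInvolution.weight 1) (FinInvolution.occClass r)) := by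
    refine FinInvolution.occ_rational_of_sqrt 1 hX one_ne_zero
      (IsRationalFunctionOf.gen (u := u) 1) (constantCoeff_seriesSqrt hc)
      ((seriesSqrt_sq hc).trans ?_) r
    rw [map_one]
    ring
  -- At `t = -1` it is `(1 - x)² + 4x² = 1 - 2x + 5x²`.
  have h2 : IsRationalFunctionOf u
      (gf (FinInvolution.weight (-1)) (FinInvolution.occClass r)) := by
    refine FinInvolution.occ_rational_of_sqrt (-1) hX (by norm_num)
      (IsRationalFunctionOf.gen (u := u) 2) (constantCoeff_seriesSqrt hc')
      ((seriesSqrt_sq hc').trans ?_) r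
    rw [map_neg, map_one]
    ring
  rw [FinInvolution.evenGF_eq, FinInvolution.oddGF_eq]
  exact ⟨(IsRationalFunctionOf.const _).mul (h1.add h2),
    (IsRationalFunctionOf.const _).mul (h1.sub h2)⟩
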